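/- Let $V$ be a valuation ring with quotient field $K$, and let $\operatorname{Int}(V)=\{f\in K[X]\mid f(V)\subseteq V\}$ be the ring of integer-valued polynomials on $V$. Assume that one of the following holds. 1. $K$ is a global field (that is, a finite extension of $\mathbb{Q}$ or of a field $\mathbb{F}(T)$ of rational functions in one variable over a finite field $\mathbb{F}$) and $V\neq K$. 2. $V$ is a discrete valuation ring (of rank one) with finite residue field, and $K$ is a purely transcendental extension, of positive (possibly infinite) transcendence degree, of some field. 3. $V$ is a discrete valuation ring (of rank one) with finite residue field, and $K$ is a finite extension of a field $L$ that has a valuation ring $W\neq L$, independent from $V\cap L$, whose maximal ideal is principal or whose residue field is finite. (Two valuation rings of $L$ are independent if together they generate $L$ as a ring.) Then for every positive integer $k$ and all integers $1<n_1\le\dots\le n_k$ there exists $H\in\operatorname{Int}(V)$ which has precisely $k$ essentially different factorizations into irreducible elements of $\operatorname{Int}(V)$, and the lengths of these factorizations are exactly $n_1,\dots,n_k$. Here a factorization of $H$ is an expression $H=a_1\cdots a_n$ with all $a_i$ irreducible in $\operatorname{Int}(V)$, $n$ is its length, and two factorizations are essentially the same if they have the same length and, after re-indexing, corresponding factors are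 associated in $\operatorname{Int}(V)$. -/

import Mathlib

open Polynomial

/-- `Int(R) = {f ∈ K[X] ∣ f(R) ⊆ R}`, the ring of integer-valued polynomials on a subring `R`
of a field `K` (in the applications `K` is the quotient field of `R`). -/
def intValuedPolynomials {K : Type*} [Field K] (R : Subring K) : Subring K[X] where
  carrier := {f | ∀ a ∈ R, f.eval a ∈ R}
  zero_mem' := fun a _ => by simp [R.zero_mem]
  one_mem' := fun a _ => by simp [R.one_mem]
  add_mem' := fun hf hg a ha => by simpa using R.add_mem (hf a ha) (hg a ha)
  mul_mem' := fun hf hg a ha => by simpa using R.mul_mem (hf a ha) (hg a ha)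
  neg_mem' := fun hf a ha => by simpa using R.neg_mem (hf a ha)

/-- `s` is (the multiset of factors of) a factorization of `r` into irreducible elements of `R`;
its length is `s.card`. -/
def IsFactorization {R : Type*} [CommRing R] (r : R) (s : Multiset R) : Prop :=
  (∀ a ∈ s, Irreducible a) ∧ s.prod = r

/-- Two factorizations are essentially the same if they have the same length and, after
re-indexing, corresponding factors are associated. -/
def EssentiallySame {R : Type*} [CommRing R] (s t : Multiset R) : Prop :=
  Multiset.Rel Associated s t

/-- `r` has precisely `k` essentially different factorizations into irreducible elements of `R`,
and their lengths are `n 0, …, n (k - 1)`. -/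
def HasExactlyFactorizationsOfLengths {R : Type*} [CommRing R] (r : R) {k : ℕ}
    (n : Fin k → ℕ) : Prop :=
  ∃ s : Fin k → Multiset R,
    (∀ i, IsFactorization r (s i) ∧ (s i).card = n i) ∧
    (∀ i j, i ≠ j → ¬ EssentiallySame (s i) (s j)) ∧
    ∀ t, IsFactorization r t → ∃ i, EssentiallySame t (s i)

/-- For all positive integers `k` and `1 < n₁ ≤ … ≤ n_k` some element of `Int(V)` has precisely `k`
essentially different factorizations into irreducible elements of `Int(V)`, of lengths
`n₁, …, n_k`. -/
def RealizesAllMultisetsOfLengths {K : Type*} [Field K] (V : ValuationSubring K) : Prop :=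
  ∀ (k : ℕ) (n : Fin k → ℕ), 0 < k → (∀ i, 1 < n i) → Monotone n →
    ∃ H : intValuedPolynomials V.toSubring, HasExactlyFactorizationsOfLengths H n

/-- A global field: a finite extension of `ℚ`, or of the field of rational functions `F(T)` over a
finite field `F`. -/
def IsGlobalField (K : Type*) [Field K] : Prop :=
  NumberField K ∨
    ∃ (F : Type) (_ : Field F) (_ : Finite F) (_ : Algebra (RatFunc F) K),
      FiniteDimensional (RatFunc F) K

/-- `K` is a purely transcendental extension of `F` of positive (possibly infinite) transcendence
degree: it is generated as a field over `F` by a non-empty algebraically independent set. -/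
def IsProperPurelyTranscendental (F K : Type*) [Field F] [Field K] [Algebra F K] : Prop :=
  ∃ S : Set K, S.Nonempty ∧ AlgebraicIndependent F ((↑) : S → K) ∧
    IntermediateField.adjoin F S = ⊤

/-- Two valuation rings of a field are independent if together they generate the field, that is,
if no valuation ring other than the field itself contains both. -/
def IndependentValuationRings {K : Type*} [Field K] (A B : ValuationSubring K) : Prop :=
  A.toSubring ⊔ B.toSubring = ⊤

/-! Let `p` be a uniformizer of `V` with valuation `v`. The element sought is `H = p⁻¹ ∏ F i`, where
the `F i` are integer-valued, irreducible in `K[X]` and pairwise non-associated. By unique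
factorization in `K[X]`, every factor of `H` in `Int(V)` is a constant times a subproduct. One index
`i₀` is distinguished: at some point `a₀` of `V` the value of `F i₀` has the valuation of `p`, and
all other `F i` take unit values. Hence, up to units, `p⁻¹` must accompany `F i₀`. A factorization
of `H` therefore amounts to a minimal set `S` containing `i₀` with `p⁻¹ ∏_{i ∈ S} F i`
integer-valued; the remaining `F i` are irreducible, and the length is one more than their number
(`IsCoverSystem.hasExactlyFactorizationsOfLengths`).

Integrality of `p⁻¹ ∏_{i ∈ S} F i` means that at each point of `V` some `F i` with `i ∈ S` takes a
non-unit value. Arrange the other indices in `k` blocks, the `r`-th of size `n r - 1`. A set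
contains the complement of some block exactly when it meets every pair of indices from different
blocks. So `V` is cut into one class for each such pair, on which just these two polynomials are
non-units, and one further class on which only `F i₀` is. Then the minimal sets are the block
complements.

Integer-valued polynomials with these residues come from `exists_clopen_partition`. They are made
irreducible by `exists_irreducible_approximation`: irreducibility is an open condition for an
auxiliary valuation ring `W`, and `W ⊄ V` allows approximation at `V` and `W` simultaneously. It
remains to find `W`. For a simple transcendental extension, the `s`-adic and `s⁻¹`-adic rings cannot
both lie in a proper `V`; over `ℚ` the 2-adic and 3-adic rings play this role. Finite extensions are
treated by extending valuation rings. -/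

/-! ### Uniformizers of valuation rings -/

/-- `p` is a non-zero generator of the maximal ideal of `V`. -/
structure IsUniformizer {K : Type*} [Field K] (V : ValuationSubring K) (p : K) : Prop where
  ne_zero : p ≠ 0
  lt_one : V.valuation p < 1
  le_of_lt_one : ∀ x, V.valuation x < 1 → V.valuation x ≤ V.valuation p

/-- Every element of `K` is carried into `V` by some power of `p`. -/
def PowAbsorbing {K : Type*} [Field K] (V : ValuationSubring K) (p : K) : Prop :=
  ∀ y : K, ∃ n : ℕ, p ^ n * y ∈ V

section

variable {K : Type*} [Field K] {V : ValuationSubring K}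

theorem mem_intValuedPolynomials {R : Subring K} {f : K[X]} :
    f ∈ intValuedPolynomials R ↔ ∀ a ∈ R, f.eval a ∈ R := Iff.rfl

theorem exists_isUniformizer (hV : V ≠ ⊤) (h : (IsLocalRing.maximalIdeal V).IsPrincipal) :
    ∃ p, IsUniformizer V p := by
  obtain ⟨⟨p, hp⟩⟩ := h
  refine ⟨p, ?_, ?_, fun x hx => ?_⟩
  · intro h0
    apply hV
    refine eq_top_iff.2 fun x _ => ?_
    by_contra hx
    have h1 : V.valuation x⁻¹ < 1 := by
      rw [← V.mem_nonunits_iff, V.inv_mem_nonunits_iff]; exact Or.inr hx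
    have h2 : x⁻¹ ∈ V := V.mem_of_valuation_le_one _ h1.le
    have h3 : (⟨x⁻¹, h2⟩ : V) ∈ IsLocalRing.maximalIdeal V := (V.valuation_lt_one_iff _).2 h1
    have h4 : p = 0 := by exact_mod_cast h0
    rw [hp, h4] at h3
    have h5 : (⟨x⁻¹, h2⟩ : V) = 0 := by simpa using h3
    have h6 : x⁻¹ = 0 := congrArg Subtype.val h5
    rw [inv_eq_zero.1 h6] at hx
    exact hx V.zero_mem
  · exact (V.valuation_lt_one_iff _).1 (hp ▸ Submodule.mem_span_singleton_self p)
  · have h2 : x ∈ V := V.mem_of_valuation_le_one _ hx.le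
    have h3 : (⟨x, h2⟩ : V) ∈ IsLocalRing.maximalIdeal V := (V.valuation_lt_one_iff _).2 hx
    rw [hp] at h3
    obtain ⟨a, ha⟩ := Ideal.mem_span_singleton'.1 h3
    exact (V.valuation_le_iff _ _).2 ⟨a, congrArg Subtype.val ha⟩

theorem IsUniformizer.ne_top {p : K} (hp : IsUniformizer V p) : V ≠ ⊤ := by
  rintro rfl
  have := (ValuationSubring.mem_nonunits_iff_or (A := ⊤)).1
    ((ValuationSubring.mem_nonunits_iff _).2 hp.lt_one)
  rcases this with h | h
  · exact hp.ne_zero h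
  · exact h (ValuationSubring.mem_top _)

theorem IsUniformizer.div_mem {p x : K} (hp : IsUniformizer V p) (hx : V.valuation x < 1) :
    p⁻¹ * x ∈ V := by
  refine V.mem_of_valuation_le_one _ ?_
  have h0 : V.valuation p ≠ 0 := (V.valuation.ne_zero_iff).2 hp.ne_zero
  rw [map_mul, map_inv₀]
  exact (inv_mul_le_one₀ (zero_lt_iff.2 h0)).2 (hp.le_of_lt_one x hx)

theorem exists_uniformizer_of_isDiscreteValuationRing [IsDiscreteValuationRing V] :
    ∃ p, IsUniformizer V p ∧ PowAbsorbing V p := by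
  obtain ⟨p, hp⟩ := IsDiscreteValuationRing.exists_irreducible V
  have hmax := hp.maximalIdeal_eq
  have hp0 : (p : K) ≠ 0 := fun h => hp.ne_zero (Subtype.ext h)
  refine ⟨p, ⟨hp0, ?_, fun x hx => ?_⟩, fun y => ?_⟩
  · exact (V.valuation_lt_one_iff _).1 (hmax ▸ Submodule.mem_span_singleton_self p)
  · have h2 : x ∈ V := V.mem_of_valuation_le_one _ hx.le
    have h3 : (⟨x, h2⟩ : V) ∈ IsLocalRing.maximalIdeal V := (V.valuation_lt_one_iff _).2 hx
    rw [hmax] at h3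
    obtain ⟨a, ha⟩ := Ideal.mem_span_singleton'.1 h3
    exact (V.valuation_le_iff _ _).2 ⟨a, congrArg Subtype.val ha⟩
  · rcases V.mem_or_inv_mem y with hy | hy
    · exact ⟨0, by simpa using hy⟩
    · by_cases h0 : y = 0
      · exact ⟨0, by simp [h0, V.zero_mem]⟩
      have hne : (⟨y⁻¹, hy⟩ : V) ≠ 0 := fun h => h0 (inv_eq_zero.1 (congrArg Subtype.val h))
      obtain ⟨n, u, hu⟩ := IsDiscreteValuationRing.associated_pow_irreducible hne hp
      refine ⟨n, ?_⟩
      have h1 : y⁻¹ * ((u : V) : K) = (p : K) ^ n := congrArg Subtype.val hu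
      rw [← h1, mul_comm y⁻¹, mul_assoc, inv_mul_cancel₀ h0, mul_one]
      exact (u : V).2

/-- Fermat's congruence `a ^ q ≡ a` modulo the maximal ideal, `q` the size of the residue field. -/
theorem valuation_pow_card_sub_lt_one [Finite (IsLocalRing.ResidueField V)] {a : K} (ha : a ∈ V) :
    V.valuation (a ^ Nat.card (IsLocalRing.ResidueField V) - a) < 1 := by
  have := Fintype.ofFinite (IsLocalRing.ResidueField V)
  set q := Nat.card (IsLocalRing.ResidueField V) with hq
  have h : (⟨a, ha⟩ : V) ^ q - ⟨a, ha⟩ ∈ IsLocalRing.maximalIdeal V := by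
    rw [← IsLocalRing.residue_eq_zero_iff, map_sub, map_pow, hq, Nat.card_eq_fintype_card,
      FiniteField.pow_card, sub_self]
  exact (V.valuation_lt_one_iff _).1 h

end

/-! ### Integer-valued polynomials with prescribed residues on clopen sets -/

section

variable {K : Type*} [Field K] {V : ValuationSubring K}

/-- Each inductive step splits off the units. Modulo the maximal ideal, `a ^ (q - 1)` is 1 on units
and 0 on non-units, so it switches between a constant and a polynomial built earlier. The latter is
evaluated at `p⁻¹ * (a ^ q - a)`, an integer-valued substitute for `a / p` that differs from it by a
unit factor on non-units; hence the invariance of the classes under units. The classes are levels of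
the valuation, the last one collecting all smaller values. -/
theorem exists_clopen_partition {p : K} (hp : IsUniformizer V p)
    [Finite (IsLocalRing.ResidueField V)] (P : Type) [Finite P] :
    ∃ cls : K → Option P,
      (∀ i, ∃ a ∈ V, cls a = i) ∧
      (∀ u a, V.valuation u = 1 → cls (u * a) = cls a) ∧
      ∀ c : Option P → K, (∀ i, c i ∈ V) → ∃ h ∈ intValuedPolynomials V.toSubring,
        ∀ a ∈ V, V.valuation (h.eval a - c (cls a)) < 1 := by
  classical
  induction P using Finite.induction_empty_option with
  | of_equiv e ih =>
    obtain ⟨cls, h1, h2, h3⟩ := ih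
    refine ⟨fun a => (cls a).map e, fun i => ?_, fun u a hu => by simp only [h2 u a hu],
      fun c hc => ?_⟩
    · obtain ⟨a, ha, h⟩ := h1 (i.map e.symm)
      exact ⟨a, ha, by simp [h]⟩
    · exact h3 (fun i => c (i.map e)) fun i => hc _
  | h_empty =>
    refine ⟨fun _ => none, fun i => ⟨0, V.zero_mem, by cases i with
      | none => rfl
      | some x => exact x.elim⟩, fun _ _ _ => rfl, fun c hc => ⟨C (c none), ?_, ?_⟩⟩
    · intro a _; simpa using hc none
    · intro a _; simp
  | h_option ih =>
    obtain ⟨cls, h1, h2, h3⟩ := ih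
    set q := Nat.card (IsLocalRing.ResidueField V) with hq
    have hq1 : 1 < q := Finite.one_lt_card
    have hp0 := hp.ne_zero
    refine ⟨fun a => if V.valuation a = 1 then none else some (cls (p⁻¹ * a)), fun i => ?_,
      fun u a hu => ?_, fun c hc => ?_⟩
    · cases i with
      | none => exact ⟨1, V.one_mem, by simp⟩
      | some i =>
        obtain ⟨b, hb, h⟩ := h1 i
        have hlt : V.valuation (p * b) < 1 := by
          rw [map_mul]
          exact (mul_le_of_le_one_right' ((V.valuation_le_one_iff b).2 hb)).trans_lt hp.lt_one
        refine ⟨p * b, V.mem_of_valuation_le_one _ hlt.le, ?_⟩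
        simp only [if_neg hlt.ne, inv_mul_cancel_left₀ hp0, h]
    · simp only [map_mul, hu, one_mul, mul_left_comm p⁻¹ u a, h2 _ _ hu]
    · obtain ⟨h, hh, hval⟩ := h3 (fun i => c (some i)) fun i => hc _
      have hφ : ∀ a ∈ V, p⁻¹ * (a ^ q - a) ∈ V := fun a ha =>
        hp.div_mem (valuation_pow_card_sub_lt_one ha)
      obtain ⟨g, hg⟩ : ∃ g : K[X], g = C (c none) * X ^ (q - 1) +
        (1 - X ^ (q - 1)) * h.comp (C p⁻¹ * (X ^ q - X)) := ⟨_, rfl⟩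
      have hev : ∀ a, g.eval a =
          c none * a ^ (q - 1) + (1 - a ^ (q - 1)) * h.eval (p⁻¹ * (a ^ q - a)) := by
        intro a; simp [hg, eval_comp]
      have hint : ∀ a ∈ V, h.eval (p⁻¹ * (a ^ q - a)) ∈ V := fun a ha => hh _ (hφ a ha)
      refine ⟨g, ?_, fun a ha => ?_⟩
      · intro a ha
        have ha' : a ∈ V := ha
        rw [hev]
        exact V.add_mem _ _ (V.mul_mem _ _ (hc _) (pow_mem ha' _))
          (V.mul_mem _ _ (sub_mem V.one_mem (pow_mem ha' _)) (hint a ha'))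
      · rw [hev]
        have hfac : a ^ q - a = a * (a ^ (q - 1) - 1) := by
          rw [mul_sub, ← pow_succ', Nat.sub_add_cancel hq1.le, mul_one]
        have hd : V.valuation (c none - h.eval (p⁻¹ * (a ^ q - a))) ≤ 1 :=
          (V.valuation_le_one_iff _).2 (sub_mem (hc _) (hint a ha))
        beta_reduce
        split_ifs with hva
        · have hlt : V.valuation (a ^ (q - 1) - 1) < 1 := by
            have := valuation_pow_card_sub_lt_one ha
            rw [← hq, hfac, map_mul, hva, one_mul] at this
            exact this
          have : c none * a ^ (q - 1) + (1 - a ^ (q - 1)) * h.eval (p⁻¹ * (a ^ q - a)) - c none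
            = (a ^ (q - 1) - 1) * (c none - h.eval (p⁻¹ * (a ^ q - a))) := by ring
          rw [this, map_mul]
          exact (mul_le_of_le_one_right' hd).trans_lt hlt
        · have hva' : V.valuation a < 1 := lt_of_le_of_ne ((V.valuation_le_one_iff a).2 ha) hva
          have hpow : V.valuation (a ^ (q - 1)) < 1 := by
            rw [map_pow]; exact pow_lt_one₀ zero_le hva' (by omega)
          have hu : V.valuation (a ^ (q - 1) - 1) = 1 := by
            rw [Valuation.map_sub_eq_of_lt_right _ (by simpa using hpow), map_one]
          have hcls : cls (p⁻¹ * (a ^ q - a)) = cls (p⁻¹ * a) := by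
            rw [hfac, mul_comm a, mul_left_comm, h2 _ _ hu]
          have hv := hval _ (hφ a ha)
          rw [hcls] at hv
          have : c none * a ^ (q - 1) + (1 - a ^ (q - 1)) * h.eval (p⁻¹ * (a ^ q - a)) -
              c (some (cls (p⁻¹ * a)))
            = a ^ (q - 1) * (c none - h.eval (p⁻¹ * (a ^ q - a))) +
              (h.eval (p⁻¹ * (a ^ q - a)) - c (some (cls (p⁻¹ * a)))) := by ring
          rw [this]
          refine Valuation.map_add_lt _ ?_ hv
          rw [map_mul]
          exact (mul_le_of_le_one_right' hd).trans_lt hpow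

end

/-! ### Irreducible polynomials approximating a given one -/

theorem FiniteField.exists_irreducible_monic_natDegree (k : Type*) [Field k] [Finite k] {n : ℕ}
    (hn : n ≠ 0) : ∃ g : k[X], g.Monic ∧ Irreducible g ∧ g.natDegree = n := by
  obtain ⟨p, hp⟩ := CharP.exists k
  have : Fact p.Prime := ⟨CharP.char_is_prime k p⟩
  have : NeZero n := ⟨hn⟩
  obtain ⟨α, hα⟩ := Field.exists_primitive_element k (FiniteField.Extension k p n)
  have hint : IsIntegral k α := IsIntegral.of_finite k α
  refine ⟨minpoly k α, minpoly.monic hint, minpoly.irreducible hint, ?_⟩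
  rw [← IntermediateField.adjoin.finrank hint, hα, IntermediateField.finrank_top',
    FiniteField.finrank_extension]

section

variable {K : Type*} [Field K]

theorem exists_monic_lift (W : ValuationSubring K) {f : K[X]} (hf : f.Monic)
    (h : ∀ j, f.coeff j ∈ W) :
    ∃ F : W[X], F.map (algebraMap W K) = f ∧ F.natDegree = f.natDegree ∧ F.Monic := by
  refine lifts_and_natDegree_eq_and_monic ((lifts_iff_coeff_lifts f).2 fun j => ?_) hf
  exact ⟨⟨_, h j⟩, rfl⟩

/-- Eisenstein's criterion: a monic polynomial of degree `n` congruent to `X ^ n + r` modulo `r ^ 2`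
still has its lower coefficients in the maximal ideal and its constant term outside the square of
that ideal. -/
theorem exists_monic_locally_irreducible_of_isUniformizer {W : ValuationSubring K} {r : K}
    (hr : IsUniformizer W r) {n : ℕ} (hn : n ≠ 0) :
    ∃ g : K[X], ∃ e : K, e ≠ 0 ∧ W.valuation e < 1 ∧ g.Monic ∧ g.natDegree = n ∧
      (∀ j, g.coeff j ∈ W) ∧
      ∀ f : K[X], f.Monic → f.natDegree = n →
        (∀ j, W.valuation (f.coeff j - g.coeff j) ≤ W.valuation e) → Irreducible f := by
  have hrW : r ∈ W := W.mem_of_valuation_le_one _ hr.lt_one.le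
  have hr0 : W.valuation r ≠ 0 := (W.valuation.ne_zero_iff).2 hr.ne_zero
  have hg : (X ^ n + C r : K[X]).Monic := monic_X_pow_add_C r hn
  have hgW : ∀ j, (X ^ n + C r : K[X]).coeff j ∈ W := fun j => by
    rw [coeff_add, coeff_X_pow, coeff_C]
    split_ifs <;> simp [hrW, W.one_mem, W.zero_mem, W.add_mem _ _ W.one_mem hrW]
  have he : W.valuation (r ^ 2) < 1 := by
    rw [map_pow]; exact pow_lt_one₀ zero_le hr.lt_one two_ne_zero
  refine ⟨X ^ n + C r, r ^ 2, pow_ne_zero 2 hr.ne_zero, he, hg, natDegree_X_pow_add_C, hgW,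
    fun f hf hfn hclose => ?_⟩
  have hfW : ∀ j, f.coeff j ∈ W := fun j => by
    have h1 : f.coeff j - (X ^ n + C r : K[X]).coeff j ∈ W :=
      W.mem_of_valuation_le_one _ ((hclose j).trans he.le)
    simpa using W.add_mem _ _ h1 (hgW j)
  obtain ⟨F, hF, hFn, hFm⟩ := exists_monic_lift W hf hfW
  have hcoeff : ∀ j, ((F.coeff j : W) : K) = f.coeff j := fun j => by
    rw [← hF, coeff_map]; rfl
  rw [← hF, ← hFm.irreducible_iff_irreducible_map_fraction_map]
  refine irreducible_of_eisenstein_criterion (P := IsLocalRing.maximalIdeal W)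
    (IsLocalRing.maximalIdeal.isMaximal W).isPrime ?_ (fun j hj => ?_) ?_ ?_ hFm.isPrimitive
  · rw [hFm.leadingCoeff]
    exact fun h => (IsLocalRing.mem_maximalIdeal _).1 h isUnit_one
  · rw [W.valuation_lt_one_iff, hcoeff]
    have hj' : j < n := by
      rw [← hfn, ← hFn]; exact (Nat.cast_lt (α := WithBot ℕ)).1 (hj.trans_le degree_le_natDegree)
    have h1 := (hclose j).trans_lt he
    have h2 : W.valuation ((X ^ n + C r : K[X]).coeff j) < 1 := by
      rw [coeff_add, coeff_X_pow, coeff_C, if_neg hj'.ne, zero_add]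
      split_ifs
      · exact hr.lt_one
      · simp
    simpa using W.valuation.map_add_lt h1 h2
  · rw [← natDegree_pos_iff_degree_pos, hFn, hfn]; omega
  · intro hmem
    have h0 := hclose 0
    rw [coeff_add, coeff_X_pow, coeff_C, if_neg hn.symm, zero_add, if_pos rfl] at h0
    have hle : ∀ x ∈ IsLocalRing.maximalIdeal W ^ 2, W.valuation (x : K) ≤ W.valuation (r ^ 2) := by
      intro x hx
      rw [pow_two] at hx
      refine Submodule.mul_induction_on hx (fun a ha b hb => ?_) (fun a b ha hb => ?_)
      · rw [W.valuation_lt_one_iff] at ha hb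
        have := mul_le_mul' (hr.le_of_lt_one _ ha) (hr.le_of_lt_one _ hb)
        rw [pow_two, map_mul]
        simpa using this
      · simpa using W.valuation.map_add_le ha hb
    have h1 := hle _ hmem
    rw [hcoeff] at h1
    have h2 := W.valuation.map_sub_le h1 h0
    rw [sub_sub_cancel, map_pow, pow_two] at h2
    exact absurd (h2.trans_lt (mul_lt_of_lt_one_right (zero_lt_iff.2 hr0) hr.lt_one)) (lt_irrefl _)

/-- Irreducibility of the reduction suffices for a monic polynomial, so any non-zero `e` in the
maximal ideal is a sufficient precision. -/
theorem exists_monic_locally_irreducible_of_finite {W : ValuationSubring K} (hW : W ≠ ⊤)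
    [Finite (IsLocalRing.ResidueField W)] {n : ℕ} (hn : n ≠ 0) :
    ∃ g : K[X], ∃ e : K, e ≠ 0 ∧ W.valuation e < 1 ∧ g.Monic ∧ g.natDegree = n ∧
      (∀ j, g.coeff j ∈ W) ∧
      ∀ f : K[X], f.Monic → f.natDegree = n →
        (∀ j, W.valuation (f.coeff j - g.coeff j) ≤ W.valuation e) → Irreducible f := by
  obtain ⟨e, he0, he⟩ : ∃ e : K, e ≠ 0 ∧ W.valuation e < 1 := by
    by_contra! h
    refine hW (eq_top_iff.2 fun x _ => ?_)
    by_contra hx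
    have h1 : W.valuation x⁻¹ < 1 := by
      rw [← W.mem_nonunits_iff, W.inv_mem_nonunits_iff]; exact Or.inr hx
    have hx0 : x ≠ 0 := by rintro rfl; exact hx W.zero_mem
    exact absurd h1 (h _ (inv_ne_zero hx0)).not_gt
  obtain ⟨gbar, hgm, hgi, hgn⟩ :=
    FiniteField.exists_irreducible_monic_natDegree (IsLocalRing.ResidueField W) hn
  obtain ⟨G, hG, hGn, hGm⟩ := lifts_and_natDegree_eq_and_monic
    (mem_lifts_of_surjective IsLocalRing.residue_surjective gbar) hgm
  refine ⟨G.map (algebraMap W K), e, he0, he, hGm.map _, by rw [hGm.natDegree_map, hGn, hgn],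
    fun j => by rw [coeff_map]; exact (G.coeff j).2, fun f hf hfn hclose => ?_⟩
  have hfW : ∀ j, f.coeff j ∈ W := fun j => by
    have h1 := W.mem_of_valuation_le_one _ ((hclose j).trans he.le)
    rw [coeff_map] at h1
    simpa using W.add_mem _ _ h1 (G.coeff j).2
  obtain ⟨F, hF, hFn, hFm⟩ := exists_monic_lift W hf hfW
  have hcoeff : ∀ j, ((F.coeff j : W) : K) = f.coeff j := fun j => by
    rw [← hF, coeff_map]; rfl
  rw [← hF, ← hFm.irreducible_iff_irreducible_map_fraction_map]
  refine hFm.irreducible_of_irreducible_map (IsLocalRing.residue W) _ ?_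
  convert hgi using 1
  rw [← hG]
  ext j
  rw [coeff_map, coeff_map, ← sub_eq_zero, ← map_sub, IsLocalRing.residue_eq_zero_iff,
    W.valuation_lt_one_iff]
  have := (hclose j).trans_lt he
  rw [coeff_map, ← hcoeff] at this
  exact this

/-- The hypothesis on the auxiliary valuation ring under which irreducible polynomials of every
positive degree exist and form open sets of coefficient vectors. -/
theorem exists_locally_irreducible {W : ValuationSubring K} (hW : W ≠ ⊤)
    (h : (∃ r, IsUniformizer W r) ∨ Finite (IsLocalRing.ResidueField W)) {n : ℕ} (hn : n ≠ 0) :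
    ∃ g : K[X], ∃ e : K, e ≠ 0 ∧ W.valuation e < 1 ∧ g.Monic ∧ g.natDegree = n ∧
      ∀ f : K[X], f.natDegree = n →
        (∀ j, W.valuation (f.coeff j - g.coeff j) ≤ W.valuation e) → Irreducible f := by
  obtain ⟨g, e, he0, he, hgm, hgn, hgW, hg⟩ : ∃ g : K[X], ∃ e : K, e ≠ 0 ∧ W.valuation e < 1 ∧
      g.Monic ∧ g.natDegree = n ∧ (∀ j, g.coeff j ∈ W) ∧
      ∀ f : K[X], f.Monic → f.natDegree = n →
        (∀ j, W.valuation (f.coeff j - g.coeff j) ≤ W.valuation e) → Irreducible f := by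
    rcases h with ⟨r, hr⟩ | h
    · exact exists_monic_locally_irreducible_of_isUniformizer hr hn
    · exact exists_monic_locally_irreducible_of_finite hW hn
  refine ⟨g, e, he0, he, hgm, hgn, fun f hfn hclose => ?_⟩
  have hgl : g.coeff n = 1 := by rw [← hgn]; exact hgm
  have hf0 : f ≠ 0 := by
    rintro rfl; exact hn hfn.symm
  -- As `l` is congruent to 1 modulo `e`, it is a unit of `W`, and dividing by it leaves the
  -- coefficients as close to those of `g` as before.
  set l := f.leadingCoeff with hl
  have hl0 : l ≠ 0 := leadingCoeff_ne_zero.2 hf0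
  have hl1 : W.valuation (l - 1) ≤ W.valuation e := by
    have := hclose n
    rwa [hgl, ← hfn] at this
  have hvl : W.valuation l = 1 := by
    have h2 := Valuation.map_add_eq_of_lt_left W.valuation
      (show W.valuation (l - 1) < W.valuation 1 by simpa using hl1.trans_lt he)
    simpa using h2
  have hirr : Irreducible (f * C l⁻¹) := by
    refine hg _ (monic_mul_leadingCoeff_inv hf0) ?_ fun j => ?_
    · rw [natDegree_mul_C (inv_ne_zero hl0), hfn]
    · have : (f * C l⁻¹).coeff j - g.coeff j =
          l⁻¹ * ((f.coeff j - g.coeff j) - (l - 1) * g.coeff j) := by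
        rw [coeff_mul_C]; field_simp; ring
      rw [this, map_mul, map_inv₀, hvl, inv_one, one_mul]
      refine W.valuation.map_sub_le (hclose j) ?_
      rw [map_mul]
      exact (mul_le_of_le_one_right' ((W.valuation_le_one_iff _).2 (hgW j))).trans hl1
  exact (irreducible_mul_isUnit (isUnit_C.2 (inv_ne_zero hl0).isUnit)).1 hirr

theorem exists_coeff_bound (V : ValuationSubring K) (f : K[X]) :
    ∃ d : K, d ≠ 0 ∧ ∀ j, V.valuation (f.coeff j) ≤ V.valuation d := by
  by_cases hf : f = 0
  · exact ⟨1, one_ne_zero, fun j => by simp [hf]⟩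
  obtain ⟨i, hi, hmax⟩ := f.support.exists_max_image (fun j => V.valuation (f.coeff j))
    (nonempty_support_iff.2 hf)
  refine ⟨f.coeff i, mem_support_iff.1 hi, fun j => ?_⟩
  by_cases hj : j ∈ f.support
  · exact hmax j hj
  · rw [notMem_support_iff.1 hj, map_zero]; exact zero_le

/-- Take `y` in `W` outside `V`. Since `V` is archimedean, a high power makes `z = e * y ^ m` large
at `V`, while it stays small at `W`; then `t = (1 + z)⁻¹` is as required. -/
theorem exists_near_zero_near_one {V W : ValuationSubring K} {p : K} (hp : IsUniformizer V p)
    (harch : PowAbsorbing V p) (hWV : ¬ W ≤ V) {d e : K} (hd : d ≠ 0) (he : e ≠ 0)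
    (he1 : W.valuation e < 1) :
    ∃ t, V.valuation t ≤ V.valuation d ∧ W.valuation (1 - t) ≤ W.valuation e := by
  obtain ⟨y, hyW, hyV⟩ := SetLike.not_le_iff_exists.1 hWV
  have hy0 : y ≠ 0 := by rintro rfl; exact hyV V.zero_mem
  have hyinv : V.valuation y⁻¹ < 1 := by
    rw [← V.mem_nonunits_iff, V.inv_mem_nonunits_iff]; exact Or.inr hyV
  -- every element of `K` is dominated by a power of `y`
  have key : ∀ x : K, ∃ m : ℕ, V.valuation x < V.valuation (y ^ m) := by
    intro x
    obtain ⟨m, hm⟩ := harch x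
    refine ⟨m + 1, ?_⟩
    have h1 : V.valuation (y⁻¹ ^ m * x) ≤ V.valuation (p ^ m * x) := by
      simp only [map_mul, map_pow]
      exact mul_le_mul_left (pow_le_pow_left₀ zero_le (hp.le_of_lt_one _ hyinv) m) _
    have h2 : V.valuation (y⁻¹ ^ m * x) ≤ 1 := h1.trans ((V.valuation_le_one_iff _).2 hm)
    have hne : V.valuation (y ^ (m + 1)) ≠ 0 := (V.valuation.ne_zero_iff).2 (pow_ne_zero _ hy0)
    have h3 : x = y ^ (m + 1) * (y⁻¹ * (y⁻¹ ^ m * x)) := by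
      field_simp; rw [one_div, inv_pow]; field_simp; ring
    rw [h3, map_mul]
    refine mul_lt_of_lt_one_right (zero_lt_iff.2 hne) ?_
    rw [map_mul]
    exact (mul_le_of_le_one_right' h2).trans_lt hyinv
  -- The exponent `m1` makes `z` exceed 1, so that `1 + z` and `z` have equal value; `m2` makes it
  -- exceed `d⁻¹`.
  obtain ⟨m1, hm1⟩ := key e⁻¹
  obtain ⟨m2, hm2⟩ := key (e⁻¹ * d⁻¹)
  have hymon : ∀ a b : ℕ, a ≤ b → V.valuation (y ^ a) ≤ V.valuation (y ^ b) := by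
    intro a b hab
    have h1 : (1 : V.ValueGroup) ≤ V.valuation y := by
      by_contra hlt
      exact hyV (V.mem_of_valuation_le_one _ (not_le.1 hlt).le)
    rw [map_pow, map_pow]
    exact pow_le_pow_right₀ h1 hab
  set z := e * y ^ (max m1 m2) with hz
  have hve : V.valuation e ≠ 0 := (V.valuation.ne_zero_iff).2 he
  have hz1 : 1 < V.valuation z := by
    have := hm1.trans_le (hymon m1 _ (le_max_left m1 m2))
    rw [map_inv₀] at this
    rw [hz, map_mul]
    calc (1 : V.ValueGroup) = V.valuation e * (V.valuation e)⁻¹ := (mul_inv_cancel₀ hve).symm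
      _ < _ := mul_lt_mul_of_pos_left this (zero_lt_iff.2 hve)
  have hz2 : V.valuation d⁻¹ < V.valuation z := by
    have := hm2.trans_le (hymon m2 _ (le_max_right m1 m2))
    rw [hz, map_mul]
    calc V.valuation d⁻¹ = V.valuation e * V.valuation (e⁻¹ * d⁻¹) := by
          rw [← map_mul, mul_inv_cancel_left₀ he]
      _ < _ := mul_lt_mul_of_pos_left this (zero_lt_iff.2 hve)
  have hvz : V.valuation (1 + z) = V.valuation z :=
    Valuation.map_add_eq_of_lt_right _ (by simpa using hz1)
  have hz0 : 1 + z ≠ 0 := by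
    rw [← V.valuation.ne_zero_iff, hvz]
    exact (zero_lt_one.trans hz1).ne'
  have hwz : W.valuation z ≤ W.valuation e := by
    rw [hz, map_mul]
    exact mul_le_of_le_one_right' ((W.valuation_le_one_iff _).2 (pow_mem hyW _))
  refine ⟨(1 + z)⁻¹, ?_, ?_⟩
  · rw [map_inv₀, hvz]
    rw [map_inv₀] at hz2
    exact inv_le_of_inv_le₀ (zero_lt_iff.2 ((V.valuation.ne_zero_iff).2 hd)) hz2.le
  · have h1 : 1 - (1 + z)⁻¹ = z * (1 + z)⁻¹ := by field_simp; ring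
    have h2 : W.valuation (1 + z) = 1 := by
      rw [Valuation.map_add_eq_of_lt_left _ (by simpa using hwz.trans_lt he1), map_one]
    rw [h1, map_mul, map_inv₀, h2, inv_one, mul_one]
    exact hwz

/-- On the line joining `f` to a locally irreducible `g` of degree `n`, the point `f + t (g - f)` is
near `f` at `V` when `t` is near 0 there, and near `g` at `W` when `t` is near 1 there. Since `n`
exceeds the degree of `f`, the degree is `n` for every non-zero `t`. -/
theorem exists_irreducible_approximation {V W : ValuationSubring K} {p : K}
    (hp : IsUniformizer V p) (harch : PowAbsorbing V p) (hWV : ¬ W ≤ V) (hW : W ≠ ⊤)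
    (h : (∃ r, IsUniformizer W r) ∨ Finite (IsLocalRing.ResidueField W))
    (f : K[X]) {n : ℕ} (hn : f.natDegree < n) {d : K} (hd : d ≠ 0) :
    ∃ F : K[X], Irreducible F ∧ F.natDegree = n ∧
      ∀ j, V.valuation (F.coeff j - f.coeff j) ≤ V.valuation d := by
  obtain ⟨g, e, he0, he, hgm, hgn, hg⟩ := exists_locally_irreducible hW h (n := n) (by omega)
  obtain ⟨a, ha0, ha⟩ := exists_coeff_bound V (g - f)
  obtain ⟨b, hb0, hb⟩ := exists_coeff_bound W (g - f)
  -- The precision `c` at `W` compensates for the size `b` of the coefficients of `g - f`; it must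
  -- also lie in the maximal ideal of `W`.
  have hc0 : ∃ c : K, c ≠ 0 ∧ W.valuation c < 1 ∧ W.valuation (c * b) ≤ W.valuation e := by
    rcases le_total (W.valuation b) 1 with hb1 | hb1
    · exact ⟨e, he0, he, by rw [map_mul]; exact mul_le_of_le_one_right' hb1⟩
    · have hvb : 0 < W.valuation b := zero_lt_one.trans_le hb1
      refine ⟨e * b⁻¹, mul_ne_zero he0 (inv_ne_zero hb0), ?_, by
        rw [inv_mul_cancel_right₀ hb0]⟩
      rw [map_mul, map_inv₀]
      exact (mul_le_of_le_one_right' (inv_le_one_of_one_le₀ hb1)).trans_lt he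
  obtain ⟨c, hc0, hc1, hcb⟩ := hc0
  obtain ⟨t, ht1, ht2⟩ := exists_near_zero_near_one hp harch hWV
    (mul_ne_zero hd (inv_ne_zero ha0)) hc0 hc1
  have ht0 : t ≠ 0 := by
    rintro rfl
    rw [sub_zero, map_one] at ht2
    exact absurd hc1 ht2.not_gt
  set F := f + C t * (g - f) with hF
  have hgf : (g - f).natDegree = n := by
    rw [natDegree_sub_eq_left_of_natDegree_lt (by omega), hgn]
  have hFn : F.natDegree = n := by
    rw [hF, natDegree_add_eq_right_of_natDegree_lt, natDegree_C_mul ht0, hgf]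
    rw [natDegree_C_mul ht0, hgf]; exact hn
  refine ⟨F, hg F hFn fun j => ?_, hFn, fun j => ?_⟩
  · have : F.coeff j - g.coeff j = - ((1 - t) * (g - f).coeff j) := by
      rw [hF, coeff_add, coeff_C_mul, coeff_sub]; ring
    rw [this, Valuation.map_neg]
    refine le_trans ?_ hcb
    rw [map_mul, map_mul]
    exact mul_le_mul' ht2 (hb j)
  · have : F.coeff j - f.coeff j = t * (g - f).coeff j := by
      rw [hF, coeff_add, coeff_C_mul]; ring
    rw [this]
    calc V.valuation (t * (g - f).coeff j) ≤ V.valuation (d * a⁻¹ * a) := by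
          rw [map_mul, map_mul _ (d * a⁻¹)]; exact mul_le_mul' ht1 (ha j)
      _ = V.valuation d := by rw [inv_mul_cancel_right₀ ha0]

theorem valuation_eval_sub_le {V : ValuationSubring K} {f g : K[X]} {d : K}
    (h : ∀ j, V.valuation (f.coeff j - g.coeff j) ≤ V.valuation d) {a : K} (ha : a ∈ V) :
    V.valuation (f.eval a - g.eval a) ≤ V.valuation d := by
  rw [← eval_sub, eval_eq_sum_range]
  refine V.valuation.map_sum_le fun j _ => ?_
  rw [map_mul, coeff_sub]
  exact (mul_le_of_le_one_right' ((V.valuation_le_one_iff _).2 (pow_mem ha j))).trans (h j)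

end

/-! ### Factorizations governed by a system of minimal covers -/

section

variable {K : Type*} [Field K] {V : ValuationSubring K} {p : K} {ι R : Type*}

/-- The functions `F i` are pairwise non-associated irreducible polynomials; those products
`∏ i ∈ S, F i` with `i₀ ∈ S` all of whose values are divisible by `p` are the ones for which `S`
contains one of the sets `B r`, and these sets form an antichain; the full product takes a
value of the same valuation as `p`, due to the factor `F i₀` alone. -/
structure IsCoverSystem (V : ValuationSubring K) (p : K)
    (F : ι → intValuedPolynomials V.toSubring) (i₀ : ι) (B : R → Finset ι) : Prop where
  ne_zero : p ≠ 0
  irreducible : ∀ i, Irreducible (F i : K[X])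
  eq_of_associated : ∀ i j, Associated (F i : K[X]) (F j : K[X]) → i = j
  exists_point : ∃ a ∈ V, V.valuation ((F i₀ : K[X]).eval a) = V.valuation p ∧
    ∀ i, i ≠ i₀ → V.valuation ((F i : K[X]).eval a) = 1
  mem : ∀ r, i₀ ∈ B r
  cover : ∀ S : Finset ι, i₀ ∈ S →
    (C p⁻¹ * ∏ i ∈ S, (F i : K[X]) ∈ intValuedPolynomials V.toSubring ↔ ∃ r, B r ⊆ S)
  antichain : ∀ r t, B r ⊆ B t → r = t

theorem exists_unit_coe_eq_C {b : K} (hb : V.valuation b = 1) :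
    ∃ u : intValuedPolynomials V.toSubring, IsUnit u ∧ (u : K[X]) = C b := by
  have hb0 : b ≠ 0 := by rintro rfl; simp at hb
  have h1 : C b ∈ intValuedPolynomials V.toSubring := fun a _ => by
    rw [eval_C]; exact V.mem_of_valuation_le_one _ hb.le
  have h2 : C b⁻¹ ∈ intValuedPolynomials V.toSubring := fun a _ => by
    rw [eval_C]; exact V.mem_of_valuation_le_one _ (by rw [map_inv₀, hb, inv_one])
  refine ⟨⟨C b, h1⟩, IsUnit.of_mul_eq_one ⟨C b⁻¹, h2⟩ (Subtype.ext ?_), rfl⟩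
  change C b * C b⁻¹ = 1
  rw [← C_mul, mul_inv_cancel₀ hb0, C_1]

theorem associated_coe {x y : intValuedPolynomials V.toSubring} (h : Associated x y) :
    Associated (x : K[X]) (y : K[X]) :=
  h.map (intValuedPolynomials V.toSubring).subtype

theorem coe_multiset_prod (t : Multiset (intValuedPolynomials V.toSubring)) :
    ((t.prod : intValuedPolynomials V.toSubring) : K[X]) =
      (t.map (intValuedPolynomials V.toSubring).subtype).prod :=
  map_multiset_prod (intValuedPolynomials V.toSubring).subtype t

namespace IsCoverSystem

variable {F : ι → intValuedPolynomials V.toSubring} {i₀ : ι} {B : R → Finset ι}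

theorem prime (h : IsCoverSystem V p F i₀ B) (i : ι) : Prime (F i : K[X]) :=
  (h.irreducible i).prime

theorem mem_of_dvd (h : IsCoverSystem V p F i₀ B) {i : ι} {b : K} (hb : b ≠ 0) {S : Finset ι}
    (hd : (F i : K[X]) ∣ C b * ∏ j ∈ S, (F j : K[X])) : i ∈ S := by
  rw [(isUnit_C.2 hb.isUnit).dvd_mul_left, (h.prime i).dvd_finsetProd_iff] at hd
  obtain ⟨j, hj, hd⟩ := hd
  rw [h.eq_of_associated i j ((h.irreducible i).associated_of_dvd (h.irreducible j) hd)]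
  exact hj

theorem dvd_of_mem {i : ι} (b : K) {S : Finset ι} (hi : i ∈ S) :
    (F i : K[X]) ∣ C b * ∏ j ∈ S, (F j : K[X]) :=
  (Finset.dvd_prod_of_mem _ hi).mul_left _

theorem not_isUnit_of_dvd (h : IsCoverSystem V p F i₀ B) {i : ι}
    {x : intValuedPolynomials V.toSubring} (hd : (F i : K[X]) ∣ x) : ¬ IsUnit x := fun hx =>
  (h.irreducible i).not_isUnit
    (isUnit_of_dvd_unit hd (hx.map (intValuedPolynomials V.toSubring).subtype))

/-- The shape of the factors is unique factorization in `K[X]`. The bounds on the constants come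
from evaluation at the point of `exists_point`, where a subproduct has the valuation of `p` or of 1
according to whether it involves `F i₀`. -/
theorem split [DecidableEq ι] (h : IsCoverSystem V p F i₀ B)
    {x y : intValuedPolynomials V.toSubring} {e : K} (he : e ≠ 0) {T : Finset ι}
    (hxy : (x : K[X]) * y = C e * ∏ i ∈ T, (F i : K[X])) :
    ∃ S ⊆ T, ∃ b b' : K, b * b' = e ∧ (x : K[X]) = C b * ∏ i ∈ S, (F i : K[X]) ∧
      (y : K[X]) = C b' * ∏ i ∈ T \ S, (F i : K[X]) ∧
      V.valuation b * (if i₀ ∈ S then V.valuation p else 1) ≤ 1 ∧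
      V.valuation b' * (if i₀ ∈ T \ S then V.valuation p else 1) ≤ 1 := by
  obtain ⟨S, U, g, g', hSU, hdisj, hg, hx, hy⟩ := mul_eq_mul_prime_prod (fun i _ => h.prime i) hxy
  have hU : U = T \ S := by
    rw [← hSU, Finset.union_sdiff_left, Finset.sdiff_eq_self_of_disjoint hdisj.symm]
  have hgu : IsUnit (g * g') := hg ▸ isUnit_C.2 he.isUnit
  obtain ⟨b, hb, rfl⟩ := isUnit_iff.1 (isUnit_of_mul_isUnit_left hgu)
  obtain ⟨b', hb', rfl⟩ := isUnit_iff.1 (isUnit_of_mul_isUnit_right hgu)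
  rw [← C_mul, C_inj] at hg
  subst hU
  refine ⟨S, hSU ▸ Finset.subset_union_left, b, b', hg.symm, hx, hy, ?_⟩
  obtain ⟨a, ha, ha0, ha1⟩ := h.exists_point
  have hval : ∀ U : Finset ι, V.valuation ((∏ i ∈ U, (F i : K[X])).eval a) =
      if i₀ ∈ U then V.valuation p else 1 := by
    intro U
    rw [eval_prod, map_prod]
    split_ifs with hU
    · rw [Finset.prod_eq_single_of_mem i₀ hU fun i _ hi => ha1 i hi, ha0]
    · exact Finset.prod_eq_one fun i hi => ha1 i fun hii => hU (hii ▸ hi)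
  constructor
  · have := (V.valuation_le_one_iff _).2 (x.2 a ha)
    rwa [hx, eval_mul, eval_C, map_mul, hval] at this
  · have := (V.valuation_le_one_iff _).2 (y.2 a ha)
    rwa [hy, eval_mul, eval_C, map_mul, hval] at this

theorem split_of_notMem [DecidableEq ι] (h : IsCoverSystem V p F i₀ B)
    {x y : intValuedPolynomials V.toSubring} {e : K} (he : V.valuation e = 1) {T : Finset ι}
    (hT : i₀ ∉ T) (hxy : (x : K[X]) * y = C e * ∏ i ∈ T, (F i : K[X])) :
    ∃ S ⊆ T, ∃ b b' : K, V.valuation b = 1 ∧ V.valuation b' = 1 ∧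
      (x : K[X]) = C b * ∏ i ∈ S, (F i : K[X]) ∧
      (y : K[X]) = C b' * ∏ i ∈ T \ S, (F i : K[X]) := by
  have he0 : e ≠ 0 := by rintro rfl; simp at he
  obtain ⟨S, hS, b, b', hbb, hx, hy, h1, h2⟩ := h.split he0 hxy
  rw [if_neg fun hi => hT (hS hi), mul_one] at h1
  rw [if_neg fun hi => hT (Finset.mem_sdiff.1 hi).1, mul_one] at h2
  have h3 : V.valuation b * V.valuation b' = 1 := by rw [← map_mul, hbb, he]
  exact ⟨S, hS, b, b', h1.antisymm (h3 ▸ mul_le_of_le_one_right' h2),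
    h2.antisymm (h3 ▸ mul_le_of_le_one_left' h1), hx, hy⟩

/-- The factor divisible by `F i₀` carries all of `p⁻¹`: the bounds `v (b * p) ≤ 1` and `v b' ≤ 1`
have product 1, so both are equalities. Integrality of `x` then puts some `B r` inside `S`. -/
theorem split_of_dvd [DecidableEq ι] (h : IsCoverSystem V p F i₀ B)
    {x y : intValuedPolynomials V.toSubring} {T : Finset ι}
    (hxy : (x : K[X]) * y = C p⁻¹ * ∏ i ∈ T, (F i : K[X])) (hd : (F i₀ : K[X]) ∣ x) :
    ∃ S ⊆ T, ∃ r, B r ⊆ S ∧ ∃ b b' : K, V.valuation b = 1 ∧ V.valuation b' = 1 ∧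
      (x : K[X]) = C b * (C p⁻¹ * ∏ i ∈ S, (F i : K[X])) ∧
      (y : K[X]) = C b' * ∏ i ∈ T \ S, (F i : K[X]) := by
  have hp0 := h.ne_zero
  obtain ⟨S, hS, b, b', hbb, hx, hy, h1, h2⟩ := h.split (inv_ne_zero hp0) hxy
  have hb0 : b ≠ 0 := left_ne_zero_of_mul (hbb ▸ inv_ne_zero hp0)
  have hi : i₀ ∈ S := h.mem_of_dvd hb0 (hx ▸ hd)
  rw [if_pos hi, ← map_mul] at h1
  rw [if_neg fun hi' => (Finset.mem_sdiff.1 hi').2 hi, mul_one] at h2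
  have h3 : V.valuation (b * p) * V.valuation b' = 1 := by
    rw [← map_mul, mul_right_comm, hbb, inv_mul_cancel₀ hp0, map_one]
  have h4 : V.valuation (b * p) = 1 := h1.antisymm (h3 ▸ mul_le_of_le_one_right' h2)
  have hx' : (x : K[X]) = C (b * p) * (C p⁻¹ * ∏ i ∈ S, (F i : K[X])) := by
    rw [hx, ← mul_assoc, ← C_mul, mul_inv_cancel_right₀ hp0]
  obtain ⟨r, hr⟩ := (h.cover S hi).1 fun a ha => by
    have hxa := x.2 a ha
    rw [hx', eval_mul, eval_C] at hxa
    refine V.mem_of_valuation_le_one _ ?_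
    have := (V.valuation_le_one_iff _).2 hxa
    rwa [map_mul, h4, one_mul] at this
  exact ⟨S, hS, r, hr, b * p, b', h4, h2.antisymm (h3 ▸ mul_le_of_le_one_left' h1), hx', hy⟩

theorem isUnit_of_coe_eq {y : intValuedPolynomials V.toSubring} {b : K}
    (hb : V.valuation b = 1) {S : Finset ι} (hS : S = ∅)
    (hy : (y : K[X]) = C b * ∏ i ∈ S, (F i : K[X])) : IsUnit y := by
  obtain ⟨u, hu, hub⟩ := exists_unit_coe_eq_C hb
  rw [hS, Finset.prod_empty, mul_one, ← hub] at hy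
  rwa [Subtype.ext hy]

theorem eq_empty_of_isUnit (h : IsCoverSystem V p F i₀ B)
    {y : intValuedPolynomials V.toSubring} {b : K} {S : Finset ι}
    (hy : (y : K[X]) = C b * ∏ i ∈ S, (F i : K[X])) (hu : IsUnit y) : S = ∅ := by
  rw [Finset.eq_empty_iff_forall_notMem]
  intro i hi
  exact h.not_isUnit_of_dvd (hy ▸ dvd_of_mem b hi) hu

theorem irreducible_of_ne [DecidableEq ι] (h : IsCoverSystem V p F i₀ B) {i : ι} (hi : i ≠ i₀) :
    Irreducible (F i) := by
  refine ⟨h.not_isUnit_of_dvd dvd_rfl, fun x y hxy => ?_⟩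
  have hxy' : (x : K[X]) * (y : K[X]) = C 1 * ∏ j ∈ ({i} : Finset ι), (F j : K[X]) := by
    rw [Finset.prod_singleton, C_1, one_mul, hxy]; rfl
  obtain ⟨S, hS, b, b', hb, hb', hx, hy⟩ := h.split_of_notMem (by simp)
    (by simpa using hi.symm) hxy'
  rcases Finset.subset_singleton_iff.1 hS with rfl | rfl
  · exact Or.inl (isUnit_of_coe_eq hb rfl hx)
  · exact Or.inr (isUnit_of_coe_eq hb' (by simp) hy)

theorem exists_coe_eq {b : K} (hb : V.valuation b = 1) (S : Finset ι) :
    ∃ y : intValuedPolynomials V.toSubring, (y : K[X]) = C b * ∏ i ∈ S, (F i : K[X]) := by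
  obtain ⟨u, -, hub⟩ := exists_unit_coe_eq_C hb
  refine ⟨u * ∏ i ∈ S, F i, ?_⟩
  rw [← hub, ← Subring.subtype_apply, map_mul, map_prod]
  rfl

theorem exists_mem_dvd {q : K[X]} (hq : Prime q) {t : Multiset (intValuedPolynomials V.toSubring)}
    (hd : q ∣ (t.prod : intValuedPolynomials V.toSubring)) :
    ∃ g ∈ t, q ∣ (g : K[X]) := by
  rw [coe_multiset_prod] at hd
  obtain ⟨g, hg, hqg⟩ := hq.exists_mem_multiset_map_dvd hd
  exact ⟨g, hg, hqg⟩

/-- Without `F i₀` all constants that occur are units of `V`, so uniqueness of factorization is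
inherited from `K[X]`. -/
theorem rel_of_prod_eq [DecidableEq ι] (h : IsCoverSystem V p F i₀ B) {T : Finset ι} :
    ∀ {t : Multiset (intValuedPolynomials V.toSubring)} {c : K}, V.valuation c = 1 → i₀ ∉ T →
      (∀ a ∈ t, Irreducible a) →
      ((t.prod : intValuedPolynomials V.toSubring) : K[X]) = C c * ∏ i ∈ T, (F i : K[X]) →
      Multiset.Rel Associated t (T.val.map F) := by
  induction T using Finset.induction_on with
  | empty =>
    intro t c hc _ hirr ht
    have hu : IsUnit t.prod := isUnit_of_coe_eq hc rfl ht
    have : t = 0 := by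
      rw [Multiset.eq_zero_iff_forall_notMem]
      intro a ha
      exact (hirr a ha).not_isUnit (isUnit_of_dvd_unit (Multiset.dvd_prod ha) hu)
    simp [this]
  | insert j T hj ih =>
    intro t c hc hT hirr ht
    obtain ⟨g, hg, hdg⟩ := exists_mem_dvd (h.prime j)
      (ht ▸ dvd_of_mem c (Finset.mem_insert_self j T))
    obtain ⟨t', rfl⟩ := Multiset.exists_cons_of_mem hg
    rw [Multiset.prod_cons] at ht
    obtain ⟨S, hS, b, b', hb, hb', hx, hy⟩ := h.split_of_notMem hc hT ht
    have hb0 : b ≠ 0 := by rintro rfl; simp at hb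
    have hjS : j ∈ S := h.mem_of_dvd hb0 (hx ▸ hdg)
    obtain ⟨y, hyv⟩ := exists_coe_eq (F := F) hb (S.erase j)
    have hgy : g = F j * y := Subtype.ext (by
      change (g : K[X]) = F j * (y : K[X])
      rw [hx, hyv, mul_left_comm, Finset.mul_prod_erase S (fun i => (F i : K[X])) hjS])
    have hyu : IsUnit y := ((hirr g hg).isUnit_or_isUnit hgy).resolve_left
      (h.not_isUnit_of_dvd dvd_rfl)
    have hSe : S = {j} := by
      rw [← Finset.insert_erase hjS, h.eq_empty_of_isUnit hyv hyu]; rfl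
    have hrest : insert j T \ S = T := by
      rw [hSe, Finset.sdiff_singleton_eq_erase, Finset.erase_insert hj]
    rw [hrest] at hy
    rw [Finset.insert_val_of_notMem hj, Multiset.map_cons]
    refine Multiset.Rel.cons ?_ (ih hb' (fun h0 => hT (Finset.mem_insert_of_mem h0))
      (fun a ha => hirr a (Multiset.mem_cons_of_mem ha)) hy)
    rw [hgy]
    exact associated_mul_unit_left _ _ hyu

/-- A factorization is determined by its factor divisible by `F i₀`. That factor is a multiple of
some `p⁻¹ ∏_{i ∈ B r} F i` and, being irreducible, is associated to it. The summand 1 in the length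
counts this factor. -/
theorem hasExactlyFactorizationsOfLengths [DecidableEq ι] [Fintype ι] {k : ℕ} (hk : 0 < k)
    {B : Fin k → Finset ι} (h : IsCoverSystem V p F i₀ B) :
    ∃ H : intValuedPolynomials V.toSubring, HasExactlyFactorizationsOfLengths H
      fun r => (Finset.univ \ B r).card + 1 := by
  have hp0 := h.ne_zero
  have hblock : ∀ r, C p⁻¹ * ∏ i ∈ B r, (F i : K[X]) ∈ intValuedPolynomials V.toSubring :=
    fun r => (h.cover _ (h.mem r)).2 ⟨r, subset_rfl⟩
  set G : Fin k → intValuedPolynomials V.toSubring := fun r => ⟨_, hblock r⟩ with hG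
  have hGc : ∀ r, (G r : K[X]) = C p⁻¹ * ∏ i ∈ B r, (F i : K[X]) := fun r => rfl
  have hGd : ∀ r, (F i₀ : K[X]) ∣ G r := fun r => dvd_of_mem _ (h.mem r)
  have hGirr : ∀ r, Irreducible (G r) := by
    -- The factor `x` already involves a whole `B r'` inside `B r`; the antichain condition gives
    -- `r' = r`, so only a unit is left for `y`.
    have key : ∀ r x y, G r = x * y → (F i₀ : K[X]) ∣ (x : K[X]) → IsUnit y := by
      intro r x y hxy hd
      obtain ⟨S, hS, r', hr', b, b', hb, hb', hx, hy⟩ := h.split_of_dvd (T := B r)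
        (by rw [← hGc, hxy]; rfl) hd
      obtain rfl := h.antichain _ _ (hr'.trans hS)
      exact isUnit_of_coe_eq hb' (Finset.sdiff_eq_empty_iff_subset.2 hr') hy
    refine fun r => ⟨h.not_isUnit_of_dvd (hGd r), fun x y hxy => ?_⟩
    have hd : (F i₀ : K[X]) ∣ (x : K[X]) * y := by
      have := hGd r
      rwa [hxy] at this
    rcases (h.prime i₀).dvd_or_dvd hd with hd | hd
    · exact Or.inr (key r x y hxy hd)
    · exact Or.inl (key r y x (hxy.trans (mul_comm x y)) hd)
  have hfull := (h.cover Finset.univ (Finset.mem_univ _)).2 ⟨⟨0, hk⟩, Finset.subset_univ _⟩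
  refine ⟨⟨_, hfull⟩, fun r => G r ::ₘ (Finset.univ \ B r).val.map F, fun r => ⟨⟨?_, ?_⟩, ?_⟩,
    fun r t hrt hsame => hrt ?_, fun t ht => ?_⟩
  · intro a ha
    rcases Multiset.mem_cons.1 ha with rfl | ha
    · exact hGirr r
    · obtain ⟨i, hi, rfl⟩ := Multiset.mem_map.1 ha
      refine h.irreducible_of_ne ?_
      rintro rfl
      exact (Finset.mem_sdiff.1 hi).2 (h.mem r)
  · refine Subtype.ext ?_
    rw [coe_multiset_prod, Multiset.map_cons, Multiset.prod_cons, Multiset.map_map]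
    change (C p⁻¹ * ∏ i ∈ B r, (F i : K[X])) * ∏ i ∈ Finset.univ \ B r, (F i : K[X]) = _
    rw [mul_assoc, mul_comm (∏ i ∈ B r, (F i : K[X])), Finset.prod_sdiff (Finset.subset_univ _)]
  · rw [Multiset.card_cons, Multiset.card_map]; rfl
  · obtain ⟨y, hy, hGy⟩ := Multiset.exists_mem_of_rel_of_mem hsame (Multiset.mem_cons_self _ _)
    have hGy' := associated_coe hGy
    rcases Multiset.mem_cons.1 hy with rfl | hy
    · refine h.antichain r t fun i hi => ?_
      refine h.mem_of_dvd (inv_ne_zero hp0) ?_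
      rw [← hGc t]
      exact (dvd_of_mem p⁻¹ hi).trans hGy'.dvd
    · obtain ⟨i, hi, rfl⟩ := Multiset.mem_map.1 hy
      have := h.eq_of_associated i₀ i
        ((h.irreducible i₀).associated_of_dvd (h.irreducible i) ((hGd r).trans hGy'.dvd))
      exact absurd (h.mem t) (this ▸ (Finset.mem_sdiff.1 hi).2)
  · obtain ⟨hirr, hprod⟩ := ht
    have hprod' : ((t.prod : intValuedPolynomials V.toSubring) : K[X]) =
        C p⁻¹ * ∏ i, (F i : K[X]) := by rw [hprod]
    obtain ⟨g, hg, hdg⟩ := exists_mem_dvd (h.prime i₀)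
      (hprod' ▸ dvd_of_mem p⁻¹ (Finset.mem_univ i₀))
    obtain ⟨t', rfl⟩ := Multiset.exists_cons_of_mem hg
    rw [Multiset.prod_cons] at hprod'
    obtain ⟨S, -, r, hr, b, b', hb, hb', hx, hy⟩ := h.split_of_dvd hprod' hdg
    obtain ⟨y, hyv⟩ := exists_coe_eq (F := F) hb (S \ B r)
    have hgy : g = G r * y := Subtype.ext (by
      change (g : K[X]) = (C p⁻¹ * ∏ i ∈ B r, (F i : K[X])) * (y : K[X])
      rw [hx, hyv, ← Finset.prod_sdiff hr]; ring)
    have hyu : IsUnit y := ((hirr g hg).isUnit_or_isUnit hgy).resolve_left (hGirr r).not_isUnit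
    have hSe : S = B r :=
      (Finset.sdiff_eq_empty_iff_subset.1 (h.eq_empty_of_isUnit hyv hyu)).antisymm hr
    subst hSe
    refine ⟨r, Multiset.Rel.cons ?_ (h.rel_of_prod_eq hb' (fun hi => ?_)
      (fun a ha => hirr a (Multiset.mem_cons_of_mem ha)) hy)⟩
    · rw [hgy]
      exact associated_mul_unit_left _ _ hyu
    · exact (Finset.mem_sdiff.1 hi).2 (h.mem r)

end IsCoverSystem

end

/-! ### Realization of prescribed lengths -/

section

variable {K : Type*} [Field K] {V : ValuationSubring K} {p : K}

theorem IsUniformizer.inv_mul_mem_iff (hp : IsUniformizer V p) {x : K} :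
    p⁻¹ * x ∈ V ↔ V.valuation x < 1 := by
  refine ⟨fun h => ?_, hp.div_mem⟩
  have h1 : x = p * (p⁻¹ * x) := by rw [mul_inv_cancel_left₀ hp.ne_zero]
  rw [h1, map_mul]
  exact (mul_le_of_le_one_right' ((V.valuation_le_one_iff _).2 h)).trans_lt hp.lt_one

theorem valuation_prod_lt_one_iff {ι : Type*} {S : Finset ι} {x : ι → K} (hx : ∀ i, x i ∈ V) :
    V.valuation (∏ i ∈ S, x i) < 1 ↔ ∃ i ∈ S, V.valuation (x i) < 1 := by
  classical
  constructor
  · intro h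
    by_contra! hS
    refine h.ne ?_
    rw [map_prod]
    exact Finset.prod_eq_one fun i hi => ((V.valuation_le_one_iff _).2 (hx i)).antisymm (hS i hi)
  · rintro ⟨i, hi, h⟩
    rw [← Finset.mul_prod_erase S x hi, map_mul]
    exact (mul_le_of_le_one_right' ((V.valuation_le_one_iff _).2
      (prod_mem fun j _ => hx j))).trans_lt h

/-- The union of all index blocks but one, together with the distinguished index `none`. -/
def blockComplement {k : ℕ} {m : Fin k → ℕ} (r : Fin k) :
    Finset (Option (Σ r : Fin k, Fin (m r))) :=
  Finset.univ.filter fun i => ∀ j, i = some j → j.1 ≠ r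

theorem mem_blockComplement {k : ℕ} {m : Fin k → ℕ} {r : Fin k}
    {i : Option (Σ r : Fin k, Fin (m r))} :
    i ∈ blockComplement r ↔ ∀ j, i = some j → j.1 ≠ r := by
  simp [blockComplement]

theorem card_compl_blockComplement {k : ℕ} {m : Fin k → ℕ} (r : Fin k) :
    (Finset.univ \ blockComplement (m := m) r).card = m r := by
  have : Finset.univ \ blockComplement (m := m) r =
      (Finset.univ : Finset (Fin (m r))).map
        ⟨fun x => some ⟨r, x⟩, fun x y h => by simpa using h⟩ := by
    ext i
    simp only [Finset.mem_sdiff, Finset.mem_univ, true_and, mem_blockComplement, Finset.mem_map]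
    constructor
    · intro h
      push Not at h
      obtain ⟨⟨s, x⟩, rfl, rfl⟩ := h
      exact ⟨x, rfl⟩
    · rintro ⟨x, rfl⟩ h
      exact h _ rfl rfl
  rw [this, Finset.card_map, Finset.card_univ, Fintype.card_fin]

theorem blockComplement_antichain {k : ℕ} {m : Fin k → ℕ} (hm : ∀ r, 0 < m r) {r t : Fin k}
    (h : blockComplement (m := m) r ⊆ blockComplement t) : r = t := by
  by_contra hrt
  have h1 : some ⟨t, ⟨0, hm t⟩⟩ ∈ blockComplement (m := m) r :=
    mem_blockComplement.2 fun j hj => by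
      rw [← Option.some.inj hj]; exact fun h => hrt h.symm
  exact mem_blockComplement.1 (h h1) _ rfl rfl

/-- A set of indices contains all blocks but one if and only if it meets every pair of indices
taken from two different blocks. -/
theorem exists_blockComplement_subset_iff {k : ℕ} {m : Fin k → ℕ} (hk : 0 < k)
    {S : Finset (Option (Σ r : Fin k, Fin (m r)))} (hS : none ∈ S) :
    (∃ r, blockComplement r ⊆ S) ↔
      ∀ x y : Σ r : Fin k, Fin (m r), x.1 ≠ y.1 → some x ∈ S ∨ some y ∈ S := by
  constructor
  · rintro ⟨r, hr⟩ x y hxy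
    by_cases hx : x.1 = r
    · refine Or.inr (hr (mem_blockComplement.2 fun j hj => ?_))
      rw [← Option.some.inj hj]
      exact fun h => hxy (hx.trans h.symm)
    · refine Or.inl (hr (mem_blockComplement.2 fun j hj => ?_))
      rw [← Option.some.inj hj]
      exact hx
  · intro h
    by_contra! hno
    have key : ∀ r : Fin k, ∃ x : Σ r : Fin k, Fin (m r), x.1 ≠ r ∧ some x ∉ S := by
      intro r
      obtain ⟨i, hi, hiS⟩ := Finset.not_subset.1 (hno r)
      cases i with
      | none => exact absurd hS hiS
      | some x => exact ⟨x, mem_blockComplement.1 hi x rfl, hiS⟩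
    obtain ⟨x, -, hx⟩ := key ⟨0, hk⟩
    obtain ⟨y, hyx, hy⟩ := key x.1
    rcases h x y hyx.symm with h | h
    · exact hx h
    · exact hy h

/-- Integer-valued polynomials whose residues modulo the maximal ideal vanish exactly on
prescribed parts of a clopen partition, with one value of the valuation of a uniformizer. -/
theorem exists_intValued_prescribed_zeros (hp : IsUniformizer V p)
    [Finite (IsLocalRing.ResidueField V)] (J P : Type) [Finite P]
    (Z : J → P → Prop) :
    ∃ (cls : K → Option P) (a₀ : K) (h : Option J → K[X]),
      (∀ c, ∃ a ∈ V, cls a = c) ∧ a₀ ∈ V ∧ cls a₀ = none ∧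
      (∀ i, ∀ a ∈ V, (h i).eval a ∈ V) ∧
      (∀ j, ∀ a ∈ V, V.valuation ((h (some j)).eval a) < 1 ↔ ∃ c, cls a = some c ∧ Z j c) ∧
      (∀ a ∈ V, V.valuation ((h none).eval a) < 1 ↔ cls a = none) ∧
      V.valuation ((h none).eval a₀) = V.valuation p := by
  classical
  obtain ⟨cls, hsurj, -, hcls⟩ := exists_clopen_partition hp P
  have hind : ∀ Q : Option P → Prop, ∃ g ∈ intValuedPolynomials V.toSubring, ∀ a ∈ V,
      V.valuation (g.eval a) < 1 ↔ Q (cls a) := by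
    intro Q
    obtain ⟨g, hg, hgv⟩ := hcls (fun c => if Q c then 0 else 1) fun c => by
      split_ifs
      · exact V.zero_mem
      · exact V.one_mem
    refine ⟨g, hg, fun a ha => ?_⟩
    have h1 := hgv a ha
    by_cases hQ : Q (cls a)
    · rw [if_pos hQ, sub_zero] at h1
      exact iff_of_true h1 hQ
    · rw [if_neg hQ] at h1
      refine iff_of_false (fun h2 => ?_) hQ
      have h3 := V.valuation.map_sub_lt h2 h1
      rw [sub_sub_cancel, map_one] at h3
      exact lt_irrefl _ h3
  obtain ⟨a₀, ha₀, hca₀⟩ := hsurj none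
  obtain ⟨g, hg, hgv⟩ := hind fun c => c = none
  choose f hf hfv using fun j => hind fun c => ∃ x, c = some x ∧ Z j x
  have hpV : p ∈ V := V.mem_of_valuation_le_one _ hp.lt_one.le
  -- The correction by `p - g.eval a₀` lies in the maximal ideal, so it does not change which values
  -- are non-units, and it makes the value at `a₀` equal to `p`.
  have heps : V.valuation (p - g.eval a₀) < 1 :=
    V.valuation.map_sub_lt hp.lt_one ((hgv a₀ ha₀).2 hca₀)
  refine ⟨cls, a₀, fun i => i.elim (g + C (p - g.eval a₀)) f, hsurj, ha₀, hca₀, ?_,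
    fun j a ha => hfv j a ha, fun a ha => ?_, ?_⟩
  · rintro (_ | j) a ha
    · simp only [Option.elim_none, eval_add, eval_C]
      exact V.add_mem _ _ (hg a ha) (sub_mem hpV (hg a₀ ha₀))
    · exact hf j a ha
  · rw [← hgv a ha]
    simp only [Option.elim_none, eval_add, eval_C]
    constructor
    · intro h
      have := V.valuation.map_sub_lt h heps
      rwa [add_sub_cancel_right] at this
    · exact fun h => V.valuation.map_add_lt h heps
  · simp

theorem realizesAllMultisetsOfLengths_of_not_le {W : ValuationSubring K}
    (hp : IsUniformizer V p) (harch : PowAbsorbing V p) [Finite (IsLocalRing.ResidueField V)]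
    (hWV : ¬ W ≤ V) (hW : W ≠ ⊤)
    (h : (∃ r, IsUniformizer W r) ∨ Finite (IsLocalRing.ResidueField W)) :
    RealizesAllMultisetsOfLengths V := by
  classical
  intro k n hk hn _
  -- Block `r` consists of the factors other than the one carrying `p⁻¹` in the `r`-th
  -- factorization, hence the size `n r - 1`.
  let J : Type := Σ r : Fin k, Fin (n r - 1)
  let P : Type := {xy : J × J // xy.1.1 ≠ xy.2.1}
  obtain ⟨cls, a₀, g, hsurj, ha₀, hca₀, hgV, hgJ, hgnone, hga₀⟩ :=
    exists_intValued_prescribed_zeros hp J P fun j c => j = c.1.1 ∨ j = c.1.2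
  let N := Finset.univ.sup fun i => (g i).natDegree
  have hN : ∀ i, (g i).natDegree ≤ N := fun i =>
    Finset.le_sup (f := fun i => (g i).natDegree) (Finset.mem_univ i)
  let e := Fintype.equivFin (Option J)
  -- Pairwise distinct degrees make the `f i` non-associated. Precision `p ^ 2` rather than `p`
  -- preserves the exact value at `a₀`.
  choose f hfirr hfdeg hfcoeff using fun i => exists_irreducible_approximation hp harch hWV hW h
    (g i) (n := N + 1 + (e i : ℕ)) (by have := hN i; omega) (pow_ne_zero 2 hp.ne_zero)
  have hp2 : V.valuation (p ^ 2) < V.valuation p := by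
    rw [pow_two, map_mul]
    exact mul_lt_of_lt_one_right (zero_lt_iff.2 ((V.valuation.ne_zero_iff).2 hp.ne_zero)) hp.lt_one
  have hclose : ∀ i, ∀ a ∈ V, V.valuation ((f i).eval a - (g i).eval a) < V.valuation p :=
    fun i a ha => (valuation_eval_sub_le (hfcoeff i) ha).trans_lt hp2
  have hfV : ∀ i, ∀ a ∈ V, (f i).eval a ∈ V := fun i a ha => by
    have := V.add_mem _ _
      (V.mem_of_valuation_le_one _ ((hclose i a ha).trans hp.lt_one).le) (hgV i a ha)
    rwa [sub_add_cancel] at this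
  have hlt : ∀ i, ∀ a ∈ V, V.valuation ((f i).eval a) < 1 ↔ V.valuation ((g i).eval a) < 1 := by
    intro i a ha
    have h1 := (hclose i a ha).trans hp.lt_one
    constructor
    · intro h2
      have := V.valuation.map_sub_lt h2 h1
      rwa [sub_sub_cancel] at this
    · intro h2
      have := V.valuation.map_add_lt h1 h2
      rwa [sub_add_cancel] at this
  have hsys : IsCoverSystem V p
      (fun i : Option J => (⟨f i, hfV i⟩ : intValuedPolynomials V.toSubring)) none
      (fun r => blockComplement (m := fun r => n r - 1) r) := by
    refine ⟨hp.ne_zero, hfirr, fun i j hij => ?_, ⟨a₀, ha₀, ?_, fun i hi => ?_⟩, fun r => ?_,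
      fun S hS => ?_, fun r t hrt => blockComplement_antichain (fun r => ?_) hrt⟩
    · have h1 : (f i).natDegree = (f j).natDegree := natDegree_eq_of_degree_eq
        (degree_eq_degree_of_associated hij)
      rw [hfdeg, hfdeg] at h1
      exact e.injective (Fin.ext (by omega))
    · change V.valuation ((f none).eval a₀) = _
      rw [← hga₀, ← sub_add_cancel ((f none).eval a₀) ((g none).eval a₀)]
      exact V.valuation.map_add_eq_of_lt_right (by rw [hga₀]; exact hclose none a₀ ha₀)
    · refine ((V.valuation_le_one_iff _).2 (hfV i a₀ ha₀)).antisymm (not_lt.1 fun h1 => ?_)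
      obtain ⟨j, rfl⟩ := Option.ne_none_iff_exists'.1 hi
      obtain ⟨c, hc, -⟩ := (hgJ j a₀ ha₀).1 ((hlt _ a₀ ha₀).1 h1)
      rw [hca₀] at hc
      exact Option.some_ne_none c hc.symm
    · exact mem_blockComplement.2 fun j hj => absurd hj.symm (Option.some_ne_none j)
    · rw [exists_blockComplement_subset_iff hk hS, mem_intValuedPolynomials]
      have hval : ∀ a ∈ V, (C p⁻¹ * ∏ i ∈ S, f i).eval a ∈ V ↔
          ∃ i ∈ S, V.valuation ((g i).eval a) < 1 := by
        intro a ha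
        rw [eval_mul, eval_C, hp.inv_mul_mem_iff, eval_prod,
          valuation_prod_lt_one_iff fun i => hfV i a ha]
        exact exists_congr fun i => and_congr_right fun _ => hlt i a ha
      constructor
      · intro hint x y hxy
        obtain ⟨a, ha, hca⟩ := hsurj (some ⟨(x, y), hxy⟩)
        obtain ⟨i, hiS, hi⟩ := (hval a ha).1 (hint a ha)
        cases i with
        | none =>
          rw [hgnone a ha, hca] at hi
          exact absurd hi (Option.some_ne_none _)
        | some j =>
          obtain ⟨c, hc, hjc⟩ := (hgJ j a ha).1 hi
          rw [hca] at hc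
          obtain rfl := Option.some.inj hc
          rcases hjc with rfl | rfl
          · exact Or.inl hiS
          · exact Or.inr hiS
      · intro hpairs a ha
        refine (hval a ha).2 ?_
        cases hca : cls a with
        | none => exact ⟨none, hS, (hgnone a ha).2 hca⟩
        | some c =>
          rcases hpairs c.1.1 c.1.2 c.2 with h1 | h1
          · exact ⟨_, h1, (hgJ _ a ha).2 ⟨c, hca, Or.inl rfl⟩⟩
          · exact ⟨_, h1, (hgJ _ a ha).2 ⟨c, hca, Or.inr rfl⟩⟩
    · have := hn r; omega
  obtain ⟨H, hH⟩ := hsys.hasExactlyFactorizationsOfLengths hk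
  refine ⟨H, ?_⟩
  convert hH using 1
  funext r
  have h1 := card_compl_blockComplement (m := fun r => n r - 1) r
  have h2 := hn r
  have h3 : (Finset.univ \ blockComplement (m := fun r => n r - 1) r).card + 1 = n r := by
    rw [h1]; omega
  exact h3.symm

end

/-! ### Valuation rings in finite extensions -/

section

variable {K : Type*} [Field K]

theorem ValuationSubring.valuation_inv_lt_one {V : ValuationSubring K} {x : K} (hx : x ∉ V) :
    V.valuation x⁻¹ < 1 := by
  rw [← V.mem_nonunits_iff, V.inv_mem_nonunits_iff]
  exact Or.inr hx

theorem ValuationSubring.valuation_le_iff_div_mem (V : ValuationSubring K) {x y : K} (hy : y ≠ 0) :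
    V.valuation x ≤ V.valuation y ↔ x / y ∈ V := by
  have h : V.valuation y ≠ 0 := (V.valuation.ne_zero_iff).2 hy
  rw [← V.valuation_le_one_iff, map_div₀, div_le_one₀ (zero_lt_iff.2 h)]

theorem exists_valuationSubring_of_ideal {R : Type*} [CommRing R] {f : R →+* K}
    (hf : Function.Injective f) {I : Ideal R} (hI : I ≠ ⊤) :
    ∃ W : ValuationSubring K, (∀ r, f r ∈ W) ∧ ∀ r ∈ I, W.valuation (f r) < 1 := by
  let e : R ≃+* f.range := RingEquiv.ofBijective f.rangeRestrict
    ⟨fun x y h => hf (congrArg Subtype.val h), f.rangeRestrict_surjective⟩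
  have hI' : I.comap e.symm ≠ ⊤ := fun h => hI ((Ideal.comap_eq_top_iff).1 h)
  obtain ⟨W, hW, hIW⟩ := Ideal.image_subset_nonunits_valuationSubring _ hI'
  refine ⟨W, fun r => hW ⟨r, rfl⟩, fun r hr => ?_⟩
  rw [← W.mem_nonunits_iff]
  refine hIW ⟨e r, ?_, rfl⟩
  change e.symm (e r) ∈ I
  rwa [e.symm_apply_apply]

variable {L : Type*} [Field L] [Algebra L K]

theorem valuation_comap_le_iff (V : ValuationSubring K) (x y : L) :
    (V.comap (algebraMap L K)).valuation x ≤ (V.comap (algebraMap L K)).valuation y ↔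
      V.valuation (algebraMap L K x) ≤ V.valuation (algebraMap L K y) := by
  by_cases hy : y = 0
  · simp [hy]
  rw [ValuationSubring.valuation_le_iff_div_mem _ hy,
    ValuationSubring.valuation_le_iff_div_mem _ ((_root_.map_ne_zero _).2 hy),
    ValuationSubring.mem_comap, map_div₀]

theorem valuation_comap_lt_one_iff (V : ValuationSubring K) (x : L) :
    (V.comap (algebraMap L K)).valuation x < 1 ↔ V.valuation (algebraMap L K x) < 1 := by
  have := valuation_comap_le_iff V 1 x
  rw [map_one, map_one, map_one] at this
  rw [← not_le, this, not_le]

/-- Choose `W'` containing `W`, with the maximal ideal of `W` consisting of non-units of `W'`. An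
element of `L` outside `W` has its inverse in that maximal ideal, so it cannot lie in `W'`. -/
theorem exists_comap_eq (W : ValuationSubring L) :
    ∃ W' : ValuationSubring K, W'.comap (algebraMap L K) = W := by
  obtain ⟨W', h1, h2⟩ := exists_valuationSubring_of_ideal
    (f := (algebraMap L K).comp W.subtype)
    ((algebraMap L K).injective.comp W.subtype_injective)
    (IsLocalRing.maximalIdeal.isMaximal W).ne_top
  refine ⟨W', le_antisymm (fun x hx => ?_) fun x hx => h1 ⟨x, hx⟩⟩
  by_contra hxW
  have h3 := W.valuation_inv_lt_one hxW
  have h4 := h2 ⟨x⁻¹, W.mem_of_valuation_le_one _ h3.le⟩ ((W.valuation_lt_one_iff _).2 h3)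
  change W'.valuation (algebraMap L K x⁻¹) < 1 at h4
  rw [← W'.mem_nonunits_iff, map_inv₀, W'.inv_mem_nonunits_iff] at h4
  rcases h4 with h4 | h4
  · rw [(map_eq_zero _).1 h4] at hxW
    exact hxW W.zero_mem
  · exact h4 hx

variable [FiniteDimensional L K]

/-- The value group of `V` is torsion of bounded exponent modulo that of `V ∩ L`. -/
theorem exists_pow_valuation_eq (V : ValuationSubring K) :
    ∃ N : ℕ, N ≠ 0 ∧ ∀ y : K, y ≠ 0 → ∃ c : L, c ≠ 0 ∧
      V.valuation (y ^ N) = V.valuation (algebraMap L K c) := by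
  refine ⟨(Module.finrank L K).factorial, Nat.factorial_ne_zero _, fun y hy => ?_⟩
  classical
  have hint : IsIntegral L y := IsIntegral.of_finite L y
  set m := minpoly L y with hm
  have hm0 : m ≠ 0 := minpoly.ne_zero hint
  have hdeg : m.natDegree ≤ Module.finrank L K := minpoly.natDegree_le y
  let w : ℕ → K := fun i => algebraMap L K (m.coeff i) * y ^ i
  have hw0 : ∀ i ∈ m.support, w i ≠ 0 := fun i hi =>
    mul_ne_zero ((_root_.map_ne_zero _).2 (mem_support_iff.1 hi)) (pow_ne_zero _ hy)
  obtain ⟨i, hi, hmax⟩ := m.support.exists_max_image (fun i => V.valuation (w i))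
    (nonempty_support_iff.2 hm0)
  have hsum : ∑ i ∈ m.support, w i = 0 := by
    have h1 := minpoly.aeval L y
    rwa [aeval_def, eval₂_eq_sum, Polynomial.sum] at h1
  -- In a vanishing sum the largest value is attained at least twice. Two such terms give `y ^ |j -
  -- i|` the value of an element of `L`, and `|j - i|` divides the factorial of the degree.
  obtain ⟨j, hj, hji, hval⟩ : ∃ j ∈ m.support, j ≠ i ∧ V.valuation (w j) = V.valuation (w i) := by
    by_contra! hno
    have h1 := V.valuation.map_sum_eq_of_lt hi (f := w) fun j hj => by
      rw [Finset.mem_sdiff, Finset.mem_singleton] at hj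
      exact lt_of_le_of_ne (hmax j hj.1) (hno j hj.1 hj.2)
    rw [hsum, map_zero] at h1
    exact hw0 i hi ((map_eq_zero _).1 h1.symm)
  have key : ∀ i j, i < j → i ∈ m.support → j ∈ m.support → V.valuation (w i) = V.valuation (w j) →
      ∃ c : L, c ≠ 0 ∧ V.valuation (y ^ (Module.finrank L K).factorial) =
        V.valuation (algebraMap L K c) := by
    intro i j hij hi hj hval
    have hjd : j ≤ Module.finrank L K := (le_natDegree_of_mem_supp j hj).trans hdeg
    obtain ⟨q, hq⟩ : j - i ∣ (Module.finrank L K).factorial :=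
      Nat.dvd_factorial (by omega) (by omega)
    have hci := mem_support_iff.1 hi
    have hcj := mem_support_iff.1 hj
    refine ⟨(m.coeff i / m.coeff j) ^ q, pow_ne_zero _ (div_ne_zero hci hcj), ?_⟩
    rw [hq, pow_mul, map_pow V.valuation (y ^ (j - i)), map_pow (algebraMap L K),
      map_pow V.valuation (algebraMap L K _)]
    congr 1
    have h1 : V.valuation (algebraMap L K (m.coeff j)) ≠ 0 :=
      (V.valuation.ne_zero_iff).2 ((_root_.map_ne_zero _).2 hcj)
    have h2 : V.valuation (y ^ i) ≠ 0 := (V.valuation.ne_zero_iff).2 (pow_ne_zero _ hy)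
    rw [map_div₀, map_div₀, eq_div_iff h1]
    refine mul_right_cancel₀ h2 ?_
    rw [← map_mul, ← map_mul, ← map_mul]
    change _ = V.valuation (w i)
    rw [hval]
    congr 1
    change _ = algebraMap L K (m.coeff j) * y ^ j
    rw [← Nat.sub_add_cancel hij.le, pow_add]
    simp only [Nat.add_sub_cancel]
    ring
  rcases lt_or_gt_of_ne hji with h | h
  · exact key j i h hj hi hval
  · exact key i j h hi hj hval.symm

variable (L) in
theorem comap_ne_top {V : ValuationSubring K} (hV : V ≠ ⊤) : V.comap (algebraMap L K) ≠ ⊤ := by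
  intro h
  refine hV (eq_top_iff.2 fun y _ => ?_)
  by_cases hy : y = 0
  · rw [hy]; exact V.zero_mem
  obtain ⟨N, hN, hpow⟩ := exists_pow_valuation_eq (L := L) V
  obtain ⟨c, -, hc⟩ := hpow y hy
  have h1 : c ∈ V.comap (algebraMap L K) := h ▸ ValuationSubring.mem_top c
  have h2 := (V.valuation_le_one_iff _).2 (ValuationSubring.mem_comap.1 h1)
  rw [← hc, map_pow, pow_le_one_iff hN] at h2
  exact V.mem_of_valuation_le_one _ h2

/-- For `y` with value below 1 but at least that of `s`, some `s ^ k` has the value of `y ^ N`. An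
element with least `k` has the largest value below 1. -/
theorem exists_isUniformizer_of_comap {V : ValuationSubring K} {r : L}
    (hr : IsUniformizer (V.comap (algebraMap L K)) r) : ∃ p : K, IsUniformizer V p := by
  classical
  obtain ⟨N, hN, hpow⟩ := exists_pow_valuation_eq (L := L) V
  set s := algebraMap L K r with hs
  have hs0 : s ≠ 0 := (_root_.map_ne_zero _).2 hr.ne_zero
  have hvs0 : V.valuation s ≠ 0 := (V.valuation.ne_zero_iff).2 hs0
  have hs1 : V.valuation s < 1 := (valuation_comap_lt_one_iff V r).1 hr.lt_one
  -- elements of `L` of valuation between powers of the uniformizer are powers of it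
  have hL : ∀ M : ℕ, ∀ c : L, V.valuation (algebraMap L K c) ≤ 1 →
      V.valuation (s ^ M) ≤ V.valuation (algebraMap L K c) →
      ∃ k, V.valuation (algebraMap L K c) = V.valuation (s ^ k) := by
    intro M
    induction M with
    | zero =>
      intro c hc hMc
      rw [pow_zero] at hMc
      exact ⟨0, by rw [pow_zero]; exact (hc.trans_eq (map_one _).symm).antisymm hMc⟩
    | succ M ih =>
      intro c hc hMc
      rcases hc.lt_or_eq with hc1 | hc1
      · have h1 := hr.le_of_lt_one c ((valuation_comap_lt_one_iff V c).2 hc1)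
        rw [valuation_comap_le_iff, ← hs] at h1
        have h2 : algebraMap L K (c / r) = algebraMap L K c / s := by rw [map_div₀]
        obtain ⟨k, hk⟩ := ih (c / r)
          (by rw [h2, map_div₀]; exact (div_le_one₀ (zero_lt_iff.2 hvs0)).2 h1)
          (by
            rw [h2, map_div₀, le_div_iff₀ (zero_lt_iff.2 hvs0), ← map_mul, ← pow_succ]
            exact hMc)
        refine ⟨k + 1, ?_⟩
        rw [h2, map_div₀, div_eq_iff hvs0, ← map_mul, ← pow_succ] at hk
        exact hk
      · exact ⟨0, by rw [hc1, pow_zero, map_one]⟩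
  have hexp : ∀ y : K, V.valuation y < 1 → V.valuation s ≤ V.valuation y →
      ∃ k, V.valuation (y ^ N) = V.valuation (s ^ k) := by
    intro y hy hsy
    have hy0 : y ≠ 0 := by
      rintro rfl
      rw [map_zero] at hsy
      exact hvs0 (le_antisymm hsy zero_le)
    obtain ⟨c, -, hc⟩ := hpow y hy0
    rw [hc]
    refine hL N c ?_ ?_
    · rw [← hc, map_pow]; exact pow_le_one₀ zero_le hy.le
    · rw [← hc, map_pow, map_pow]; exact pow_le_pow_left₀ zero_le hsy N
  have hex : ∃ k, ∃ y : K, V.valuation y < 1 ∧ V.valuation s ≤ V.valuation y ∧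
      V.valuation (y ^ N) = V.valuation (s ^ k) := ⟨N, s, hs1, le_rfl, rfl⟩
  obtain ⟨p, hp1, hsp, hpk⟩ := Nat.find_spec hex
  refine ⟨p, ?_, hp1, fun x hx => ?_⟩
  · rintro rfl
    rw [map_zero] at hsp
    exact hvs0 (le_antisymm hsp zero_le)
  · by_contra! hlt
    have hsx := hsp.trans hlt.le
    obtain ⟨k, hk⟩ := hexp x hx hsx
    have hkmin := Nat.find_min' hex ⟨x, hx, hsx, hk⟩
    have h1 : V.valuation (x ^ N) ≤ V.valuation (p ^ N) := by
      rw [hk, hpk, map_pow, map_pow]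
      exact pow_le_pow_of_le_one zero_le hs1.le hkmin
    rw [map_pow, map_pow] at h1
    exact h1.not_gt (pow_lt_pow_left₀ hlt zero_le hN)

theorem powAbsorbing_of_comap {V : ValuationSubring K} {r : L} {p : K}
    (hr : IsUniformizer (V.comap (algebraMap L K)) r)
    (hr' : PowAbsorbing (V.comap (algebraMap L K)) r) (hp : IsUniformizer V p) :
    PowAbsorbing V p := by
  obtain ⟨N, hN, hpow⟩ := exists_pow_valuation_eq (L := L) V
  intro y
  by_cases hy : y = 0
  · exact ⟨0, by rw [hy, mul_zero]; exact V.zero_mem⟩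
  obtain ⟨c, -, hc⟩ := hpow y hy
  obtain ⟨d, -, hd⟩ := hpow p hp.ne_zero
  have hd1 : V.valuation (algebraMap L K d) < 1 := by
    rw [← hd, map_pow]; exact pow_lt_one₀ zero_le hp.lt_one hN
  have hdr := hr.le_of_lt_one d ((valuation_comap_lt_one_iff V d).2 hd1)
  rw [valuation_comap_le_iff] at hdr
  obtain ⟨n, hn⟩ := hr' c
  refine ⟨n, V.mem_of_valuation_le_one _ ?_⟩
  rw [ValuationSubring.mem_comap, ← V.valuation_le_one_iff] at hn
  rw [← pow_le_one_iff hN, ← map_pow]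
  calc V.valuation ((p ^ n * y) ^ N)
      = V.valuation (algebraMap L K d) ^ n * V.valuation (algebraMap L K c) := by
        rw [mul_pow, ← pow_mul, mul_comm n, pow_mul, map_mul, map_pow, hd, hc]
    _ ≤ V.valuation (algebraMap L K r) ^ n * V.valuation (algebraMap L K c) :=
        mul_le_mul_left (pow_le_pow_left₀ zero_le hdr n) _
    _ ≤ 1 := by rwa [map_mul, map_mul, map_pow, map_pow] at hn

theorem Polynomial.finite_setOf_natDegree_lt (k : Type*) [Field k] [Finite k] (n : ℕ) :
    {q : k[X] | q.degree < n}.Finite := by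
  have h1 : Finite (degreeLT k n) := Finite.of_equiv _ (degreeLTEquiv k n).toEquiv.symm
  have h2 : {q : k[X] | q.degree < n} = (degreeLT k n : Set k[X]) := by
    ext q; exact (mem_degreeLT).symm
  rw [h2]
  exact Set.toFinite _

/-- There are finitely many polynomials of bounded degree over a finite field, and each non-zero one
has finitely many roots. -/
theorem finite_of_exists_root {k₀ k : Type*} [Field k₀] [Finite k₀] [Field k] (φ : k₀ →+* k)
    (n : ℕ) (h : ∀ x : k, ∃ q : k₀[X], q ≠ 0 ∧ q.degree < n ∧ q.eval₂ φ x = 0) : Finite k := by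
  classical
  rw [← Set.finite_univ_iff]
  refine Set.Finite.subset (Set.Finite.biUnion (finite_setOf_natDegree_lt k₀ n)
    (t := fun q => ((q.map φ).roots.toFinset : Set k)) fun q _ => Finset.finite_toSet _) ?_
  intro x _
  obtain ⟨q, hq0, hqn, hq⟩ := h x
  refine Set.mem_biUnion (show q ∈ {q : k₀[X] | q.degree < n} from hqn) ?_
  rw [Finset.mem_coe, Multiset.mem_toFinset, mem_roots ((Polynomial.map_ne_zero hq0)),
    IsRoot.def, eval_map]
  exact hq

-- Divide the minimal polynomial of a representative by its coefficient of largest value. The result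
-- has coefficients in `V ∩ L`, one of them equal to 1, so it reduces to a non-zero polynomial of
-- degree at most `[K : L]` that annihilates the residue.
variable (L) in
theorem finite_residueField_of_comap {V : ValuationSubring K}
    [Finite (IsLocalRing.ResidueField (V.comap (algebraMap L K)))] :
    Finite (IsLocalRing.ResidueField V) := by
  set V₀ := V.comap (algebraMap L K) with hV₀
  let f : V₀ →+* V := (algebraMap L K).restrict V₀ V fun x hx => hx
  have hfv : ∀ x, ((f x : V) : K) = algebraMap L K x := fun _ => rfl
  have hloc : IsLocalHom f := ⟨fun x hx => by
    by_contra hxu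
    have h1 : V₀.valuation (x : L) < 1 :=
      (V₀.valuation_lt_one_iff x).1 ((IsLocalRing.mem_maximalIdeal x).2 hxu)
    rw [valuation_comap_lt_one_iff, ← hfv, ← V.valuation_lt_one_iff] at h1
    exact (IsLocalRing.mem_maximalIdeal _).1 h1 hx⟩
  refine finite_of_exists_root (IsLocalRing.ResidueField.map f) (Module.finrank L K + 1) fun z => ?_
  obtain ⟨x, rfl⟩ := IsLocalRing.residue_surjective z
  have hint : IsIntegral L (x : K) := IsIntegral.of_finite L _
  set m := minpoly L (x : K) with hm
  have hm0 : m ≠ 0 := minpoly.ne_zero hint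
  have hdeg : m.natDegree ≤ Module.finrank L K := minpoly.natDegree_le _
  obtain ⟨i, hi, hmax⟩ := m.support.exists_max_image (fun i => V₀.valuation (m.coeff i))
    (nonempty_support_iff.2 hm0)
  have hci := mem_support_iff.1 hi
  have hvi : V₀.valuation (m.coeff i) ≠ 0 := (Valuation.ne_zero_iff _).2 hci
  have hlift : C (m.coeff i)⁻¹ * m ∈ lifts (algebraMap V₀ L) := by
    rw [lifts_iff_coeff_lifts]
    intro j
    refine ⟨⟨(C (m.coeff i)⁻¹ * m).coeff j, V₀.mem_of_valuation_le_one _ ?_⟩, rfl⟩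
    rw [coeff_C_mul, map_mul, map_inv₀, inv_mul_le_one₀ (zero_lt_iff.2 hvi)]
    by_cases hj : j ∈ m.support
    · exact hmax j hj
    · rw [notMem_support_iff.1 hj, map_zero]; exact zero_le
  obtain ⟨G, hG, hGn⟩ := exists_natDegree_eq_of_mem_lifts hlift
  have hGi : G.coeff i = 1 := by
    have h1 : algebraMap V₀ L (G.coeff i) = 1 := by
      rw [← coeff_map, hG, coeff_C_mul, inv_mul_cancel₀ hci]
    exact Subtype.ext h1
  refine ⟨G.map (IsLocalRing.residue V₀), fun h0 => ?_, ?_, ?_⟩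
  · have h1 : (G.map (IsLocalRing.residue V₀)).coeff i = 1 := by rw [coeff_map, hGi, map_one]
    rw [h0, coeff_zero] at h1
    exact zero_ne_one h1
  · refine degree_map_le.trans_lt (degree_le_natDegree.trans_lt ?_)
    rw [hGn, natDegree_C_mul (inv_ne_zero hci)]
    exact_mod_cast Nat.lt_succ_of_le hdeg
  · have h1 : G.eval₂ f x = 0 := by
      refine Subtype.ext ?_
      have h2 : ((G.eval₂ f x : V) : K) = G.eval₂ ((algebraMap L K).comp (algebraMap V₀ L)) x := by
        rw [← V.subtype_apply, hom_eval₂]; rfl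
      rw [h2, ← eval₂_map, hG, ← aeval_def, map_mul, minpoly.aeval, mul_zero]
      rfl
    rw [eval₂_map, IsLocalRing.ResidueField.map_comp_residue, ← hom_eval₂, h1, map_zero]

end

/-! ### Valuation rings containing a principal ideal domain -/

section

variable {L : Type*} [Field L]

theorem PowAbsorbing.eq_top_of_le {W V : ValuationSubring L} {p : L} (h : PowAbsorbing W p)
    (hp : p ≠ 0) (hWV : W ≤ V) (hpV : p⁻¹ ∈ V) : V = ⊤ := by
  refine eq_top_iff.2 fun y _ => ?_
  obtain ⟨n, hn⟩ := h y
  have h1 : y = p⁻¹ ^ n * (p ^ n * y) := by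
    rw [← mul_assoc, ← mul_pow, inv_mul_cancel₀ hp, one_pow, one_mul]
  rw [h1]
  exact V.mul_mem _ _ (pow_mem hpV n) (hWV hn)

theorem finite_residueField_of_surjective {R : Type*} [CommRing R] [Algebra R L]
    {V : ValuationSubring L} {p : R}
    (hR : ∀ r, algebraMap R L r ∈ V)
    (hdvd : ∀ r, V.valuation (algebraMap R L r) < 1 ↔ p ∣ r)
    (hsurj : ∀ x ∈ V, ∃ r : R, V.valuation (x - algebraMap R L r) < 1)
    [Finite (R ⧸ Ideal.span {p})] : Finite (IsLocalRing.ResidueField V) := by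
  let f : R →+* V := (algebraMap R L).codRestrict V hR
  let g : R ⧸ Ideal.span {p} →+* IsLocalRing.ResidueField V :=
    Ideal.Quotient.lift _ ((IsLocalRing.residue V).comp f) fun r hr => by
      rw [Ideal.mem_span_singleton, ← hdvd] at hr
      rw [RingHom.comp_apply, IsLocalRing.residue_eq_zero_iff]
      exact (V.valuation_lt_one_iff (f r)).2 hr
  refine Finite.of_surjective g fun z => ?_
  obtain ⟨x, rfl⟩ := IsLocalRing.residue_surjective z
  obtain ⟨r, hr⟩ := hsurj x x.2
  refine ⟨Ideal.Quotient.mk _ r, ?_⟩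
  rw [Ideal.Quotient.lift_mk, RingHom.comp_apply, eq_comm, ← sub_eq_zero, ← map_sub,
    IsLocalRing.residue_eq_zero_iff]
  exact (V.valuation_lt_one_iff (x - f r)).2 hr

variable {R : Type*} [CommRing R] [IsDomain R] [IsPrincipalIdealRing R] [Algebra R L]
  [IsFractionRing R L]

/-- A proper valuation ring containing a principal ideal domain with the same quotient field is a
discrete valuation ring whose uniformizer is a prime of that domain. -/
theorem exists_prime_isUniformizer {V : ValuationSubring L} (hV : V ≠ ⊤)
    (hR : ∀ r, algebraMap R L r ∈ V) :
    ∃ p : R, Prime p ∧ IsUniformizer V (algebraMap R L p) ∧ PowAbsorbing V (algebraMap R L p) ∧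
      (∀ r, V.valuation (algebraMap R L r) < 1 ↔ p ∣ r) ∧
      ∀ x ∈ V, ∃ r : R, V.valuation (x - algebraMap R L r) < 1 := by
  let f : R →+* V := (algebraMap R L).codRestrict V hR
  -- The centre of `V` on `R`. If its generator were 0, all non-zero elements of `R` would be units
  -- of `V`, forcing `V = L`.
  let I : Ideal R := (IsLocalRing.maximalIdeal V).comap f
  have hI : ∀ r, r ∈ I ↔ V.valuation (algebraMap R L r) < 1 := fun r =>
    V.valuation_lt_one_iff (f r)
  have hIp : I.IsPrime := Ideal.comap_isPrime f _
  obtain ⟨p, hp⟩ := (IsPrincipalIdealRing.principal I).principal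
  have hdvd : ∀ r, V.valuation (algebraMap R L r) < 1 ↔ p ∣ r := fun r => by
    rw [← hI, hp]; exact Ideal.mem_span_singleton
  have hle : ∀ r, V.valuation (algebraMap R L r) ≤ 1 := fun r => (V.valuation_le_one_iff _).2 (hR r)
  have hunit : ∀ r, ¬ p ∣ r → V.valuation (algebraMap R L r) = 1 := fun r hr =>
    (hle r).antisymm (not_lt.1 fun h => hr ((hdvd r).1 h))
  have hp0 : p ≠ 0 := by
    rintro rfl
    refine hV (eq_top_iff.2 fun y _ => ?_)
    obtain ⟨a, b, hb, rfl⟩ := IsFractionRing.div_surjective R y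
    refine V.mem_of_valuation_le_one _ ?_
    rw [map_div₀, hunit b fun h => nonZeroDivisors.ne_zero hb (zero_dvd_iff.1 h), div_one]
    exact hle a
  have hpp : Prime p := by
    rw [← Ideal.span_singleton_prime hp0]
    exact (show Ideal.span {p} = I from hp.symm) ▸ hIp
  have hpL : algebraMap R L p ≠ 0 := by
    simpa using (IsFractionRing.injective R L).ne hp0
  -- elements of `V` are fractions with denominator prime to `p`
  have hfrac : ∀ x ∈ V, ∃ a b : R, ¬ p ∣ b ∧ x = algebraMap R L a / algebraMap R L b := by
    intro x hx
    obtain ⟨a, b, hab, rfl⟩ := IsFractionRing.exists_reduced_fraction R x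
    refine ⟨a, b, fun hpb => ?_, IsFractionRing.mk'_eq_div _⟩
    have hpa : ¬ p ∣ a := fun hpa => hpp.not_isUnit (hab hpa hpb)
    have hb0 : V.valuation (algebraMap R L b) ≠ 0 := by
      rw [Valuation.ne_zero_iff]
      simp
    rw [IsFractionRing.mk'_eq_div, ← V.valuation_le_one_iff, map_div₀, hunit a hpa,
      div_le_one₀ (zero_lt_iff.2 hb0)] at hx
    exact hx.not_gt ((hdvd _).2 hpb)
  refine ⟨p, hpp, ⟨hpL, (hdvd p).2 dvd_rfl, fun x hx => ?_⟩, fun y => ?_, hdvd, fun x hx => ?_⟩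
  · obtain ⟨a, b, hb, rfl⟩ := hfrac x (V.mem_of_valuation_le_one _ hx.le)
    rw [map_div₀, hunit b hb, div_one] at hx ⊢
    obtain ⟨c, rfl⟩ := (hdvd a).1 hx
    rw [map_mul, map_mul]
    exact mul_le_of_le_one_right' (hle c)
  · obtain ⟨a, b, hb, rfl⟩ := IsFractionRing.div_surjective R y
    have hb0 := nonZeroDivisors.ne_zero hb
    obtain ⟨c, hbc, hc⟩ := (FiniteMultiplicity.of_prime_left hpp hb0).exists_eq_pow_mul_and_not_dvd
    refine ⟨multiplicity p b, V.mem_of_valuation_le_one _ ?_⟩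
    have hc0 : algebraMap R L c ≠ 0 := by
      rw [← V.valuation.ne_zero_iff, hunit c hc]; exact one_ne_zero
    have h1 : algebraMap R L p ^ multiplicity p b * (algebraMap R L a / algebraMap R L b) =
        algebraMap R L a / algebraMap R L c := by
      have h2 : algebraMap R L b = algebraMap R L p ^ multiplicity p b * algebraMap R L c := by
        rw [← map_pow, ← map_mul, ← hbc]
      rw [h2]
      field_simp
    rw [h1, map_div₀, hunit c hc, div_one]
    exact hle a
  · obtain ⟨a, b, hb, rfl⟩ := hfrac x hx
    -- By Bézout, `w` inverts the denominator `b` modulo `p`, so `w * a` represents the residue of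
    -- `a / b`.
    obtain ⟨u, w, huw⟩ := (hpp.irreducible.coprime_iff_not_dvd).2 hb
    have hb0 : algebraMap R L b ≠ 0 := by
      rw [← V.valuation.ne_zero_iff, hunit b hb]; exact one_ne_zero
    refine ⟨w * a, ?_⟩
    have huw' : algebraMap R L u * algebraMap R L p + algebraMap R L w * algebraMap R L b = 1 := by
      rw [← map_mul, ← map_mul, ← map_add, huw, map_one]
    have h1 : algebraMap R L a / algebraMap R L b - algebraMap R L (w * a) =
        algebraMap R L (p * (u * a)) / algebraMap R L b := by
      simp only [map_mul]
      rw [div_sub' hb0]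
      congr 1
      linear_combination (-algebraMap R L a) * huw'
    rw [h1, map_div₀, hunit b hb, div_one]
    exact (hdvd _).2 (dvd_mul_right p _)

theorem IsUniformizer.congr {V : ValuationSubring L} {p q : L} (hp : IsUniformizer V p)
    (h : V.valuation p = V.valuation q) : IsUniformizer V q :=
  ⟨fun hq => hp.ne_zero ((map_eq_zero V.valuation).1 (by rw [h, hq, map_zero])), h ▸ hp.lt_one,
    fun x hx => h ▸ hp.le_of_lt_one x hx⟩

theorem PowAbsorbing.congr {V : ValuationSubring L} {p q : L} (hp : PowAbsorbing V p)
    (h : V.valuation p = V.valuation q) : PowAbsorbing V q := fun y => by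
  obtain ⟨n, hn⟩ := hp y
  refine ⟨n, ?_⟩
  rwa [← V.valuation_le_one_iff, map_mul, map_pow, ← h, ← map_pow, ← map_mul,
    V.valuation_le_one_iff]

variable (L) in
theorem exists_valuationSubring_of_prime {q : R} (hq : Prime q) :
    ∃ W : ValuationSubring L, IsUniformizer W (algebraMap R L q) ∧
      PowAbsorbing W (algebraMap R L q) ∧
      ∀ r, ¬ q ∣ r → (algebraMap R L r)⁻¹ ∈ W := by
  obtain ⟨W, hRW, hqW⟩ := exists_valuationSubring_of_ideal (IsFractionRing.injective R L)
    (I := Ideal.span {q}) (by rw [Ne, Ideal.span_singleton_eq_top]; exact hq.not_isUnit)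
  have hq1 := hqW q (Ideal.mem_span_singleton_self q)
  have hW : W ≠ ⊤ := by
    rintro rfl
    rw [← ValuationSubring.mem_nonunits_iff, ValuationSubring.mem_nonunits_iff_or] at hq1
    rcases hq1 with h | h
    · exact hq.ne_zero (IsFractionRing.injective R L (h.trans (map_zero _).symm))
    · exact h (ValuationSubring.mem_top _)
  obtain ⟨p, hp, hpu, hpa, hdvd, -⟩ := exists_prime_isUniformizer hW hRW
  have hassoc := hp.irreducible.associated_of_dvd hq.irreducible ((hdvd q).1 hq1)
  obtain ⟨u, hu⟩ := id hassoc
  have hval : ∀ r, ¬ p ∣ r → W.valuation (algebraMap R L r) = 1 := fun r hr =>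
    ((W.valuation_le_one_iff _).2 (hRW r)).antisymm (not_lt.1 fun h => hr ((hdvd r).1 h))
  have hpq : W.valuation (algebraMap R L p) = W.valuation (algebraMap R L q) := by
    rw [← hu, map_mul, map_mul, hval u fun h => hp.not_isUnit (isUnit_of_dvd_unit h u.isUnit),
      mul_one]
  refine ⟨W, hpu.congr hpq, hpa.congr hpq, fun r hr => W.mem_of_valuation_le_one _ ?_⟩
  rw [map_inv₀, hval r fun h => hr (hassoc.dvd'.trans h), inv_one]

end

/-! ### Simple transcendental extensions -/

section

variable {F L : Type*} [Field F] [Field L] [Algebra F L] {s : L}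

theorem isFractionRing_aeval (hs : Transcendental F s) (htop : IntermediateField.adjoin F {s} = ⊤) :
    letI := (aeval (R := F) s).toRingHom.toAlgebra
    IsFractionRing F[X] L := by
  let := (aeval (R := F) s).toRingHom.toAlgebra
  have hinj : Function.Injective (algebraMap F[X] L) := transcendental_iff_injective.1 hs
  have : FaithfulSMul F[X] L := (faithfulSMul_iff_algebraMap_injective _ _).2 hinj
  refine IsFractionRing.of_field _ _ fun z => ?_
  have hz : z ∈ IntermediateField.adjoin F {s} := htop ▸ IntermediateField.mem_top
  obtain ⟨a, b, h⟩ := (IntermediateField.mem_adjoin_simple_iff F z).1 hz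
  exact ⟨a, b, h⟩

theorem transcendental_inv (hs : Transcendental F s) : Transcendental F s⁻¹ := fun h =>
  hs (inv_inv s ▸ h.inv)

theorem adjoin_inv_eq_top (htop : IntermediateField.adjoin F {s} = ⊤) :
    IntermediateField.adjoin F {s⁻¹} = ⊤ := by
  rw [← top_le_iff, ← htop, IntermediateField.adjoin_simple_le_iff]
  have := inv_mem (IntermediateField.mem_adjoin_simple_self F s⁻¹)
  rwa [inv_inv] at this

theorem exists_valuationSubring_of_transcendental (hs : Transcendental F s)
    (htop : IntermediateField.adjoin F {s} = ⊤) :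
    ∃ W : ValuationSubring L, IsUniformizer W s ∧ PowAbsorbing W s := by
  let := (aeval (R := F) s).toRingHom.toAlgebra
  have := isFractionRing_aeval hs htop
  obtain ⟨W, h1, h2, -⟩ := exists_valuationSubring_of_prime L (Polynomial.prime_X (R := F))
  have hX : algebraMap F[X] L X = s := aeval_X s
  rw [hX] at h1 h2
  exact ⟨W, h1, h2⟩

/-- If `V` contained both the `s`-adic and the `s⁻¹`-adic ring, then `s⁻¹` would lie in `V` along
with the former, which together generate `L`. So one of the two rings is not contained in `V`. -/
theorem exists_independent_of_transcendental (hs : Transcendental F s)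
    (htop : IntermediateField.adjoin F {s} = ⊤) {V : ValuationSubring L} (hV : V ≠ ⊤) :
    ∃ W : ValuationSubring L, (∃ r, IsUniformizer W r) ∧ ¬ W ≤ V := by
  obtain ⟨W, hW1, hW2⟩ := exists_valuationSubring_of_transcendental hs htop
  obtain ⟨W', hW1', -⟩ := exists_valuationSubring_of_transcendental (transcendental_inv hs)
    (adjoin_inv_eq_top htop)
  by_cases h : W ≤ V
  · refine ⟨W', ⟨_, hW1'⟩, fun h' => hV ?_⟩
    exact hW2.eq_top_of_le hW1.ne_zero h (h' (W'.mem_of_valuation_le_one _ hW1'.lt_one.le))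
  · exact ⟨W, ⟨_, hW1⟩, h⟩

/-- The equation `x ^ q = x` is incompatible with a value exceeding 1. -/
theorem algebraMap_mem_of_finite [Finite F] (V : ValuationSubring L) (x : F) :
    algebraMap F L x ∈ V := by
  have := Fintype.ofFinite F
  refine V.mem_of_valuation_le_one _ (not_lt.1 fun h => ?_)
  have h1 := lt_self_pow₀ h (Fintype.one_lt_card (α := F))
  rw [← map_pow, ← map_pow, FiniteField.pow_card] at h1
  exact lt_irrefl _ h1

theorem discrete_of_transcendental_of_mem [Finite F] (hs : Transcendental F s)
    (htop : IntermediateField.adjoin F {s} = ⊤) {V : ValuationSubring L} (hV : V ≠ ⊤)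
    (hsV : s ∈ V) :
    (∃ p, IsUniformizer V p ∧ PowAbsorbing V p) ∧ Finite (IsLocalRing.ResidueField V) := by
  let := (aeval (R := F) s).toRingHom.toAlgebra
  have := isFractionRing_aeval hs htop
  have hR : ∀ r : F[X], algebraMap F[X] L r ∈ V := fun r => by
    change aeval s r ∈ V
    rw [aeval_eq_sum_range]
    refine sum_mem fun i _ => ?_
    rw [Algebra.smul_def]
    exact V.mul_mem _ _ (algebraMap_mem_of_finite V _) (pow_mem hsV i)
  obtain ⟨p, hp, hpu, hpa, hdvd, hsurj⟩ := exists_prime_isUniformizer hV hR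
  have : Module.Finite F (AdjoinRoot p) := (AdjoinRoot.powerBasis hp.ne_zero).finite
  have : Finite (F[X] ⧸ Ideal.span {p}) := Module.finite_of_finite F (M := AdjoinRoot p)
  exact ⟨⟨_, hpu, hpa⟩, finite_residueField_of_surjective hR hdvd hsurj⟩

/-- One of the principal ideal domains `F[s]` and `F[s⁻¹]` lies in `V`, and both have quotient field
`L`. -/
theorem discrete_of_transcendental [Finite F] (hs : Transcendental F s)
    (htop : IntermediateField.adjoin F {s} = ⊤) {V : ValuationSubring L} (hV : V ≠ ⊤) :
    (∃ p, IsUniformizer V p ∧ PowAbsorbing V p) ∧ Finite (IsLocalRing.ResidueField V) := by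
  rcases V.mem_or_inv_mem s with h | h
  · exact discrete_of_transcendental_of_mem hs htop hV h
  · exact discrete_of_transcendental_of_mem (transcendental_inv hs) (adjoin_inv_eq_top htop) hV h

end

/-! ### The field of rational numbers -/

theorem discrete_of_rat {V : ValuationSubring ℚ} (hV : V ≠ ⊤) :
    (∃ p, IsUniformizer V p ∧ PowAbsorbing V p) ∧ Finite (IsLocalRing.ResidueField V) := by
  have hR : ∀ r : ℤ, algebraMap ℤ ℚ r ∈ V := fun r => by
    rw [eq_intCast]; exact intCast_mem V r
  obtain ⟨p, hp, hpu, hpa, hdvd, hsurj⟩ := exists_prime_isUniformizer hV hR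
  have : Finite (ℤ ⧸ Ideal.span {p}) := Ideal.finiteQuotientOfFreeOfNeBot _ (by
    rw [Ne, Ideal.span_singleton_eq_bot]; exact hp.ne_zero)
  exact ⟨⟨_, hpu, hpa⟩, finite_residueField_of_surjective hR hdvd hsurj⟩

theorem exists_independent_rat {V : ValuationSubring ℚ} (hV : V ≠ ⊤) :
    ∃ W : ValuationSubring ℚ, (∃ r, IsUniformizer W r) ∧ ¬ W ≤ V := by
  obtain ⟨W, hW1, hW2, -⟩ := exists_valuationSubring_of_prime ℚ Int.prime_two
  obtain ⟨W', hW1', -, hW3'⟩ := exists_valuationSubring_of_prime ℚ Int.prime_three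
  -- The 3-adic ring contains `2⁻¹`; a ring containing it and the 2-adic ring is all of `ℚ`.
  by_cases h : W ≤ V
  · refine ⟨W', ⟨_, hW1'⟩, fun h' => hV ?_⟩
    exact hW2.eq_top_of_le hW1.ne_zero h (h' (hW3' 2 (by norm_num)))
  · exact ⟨W, ⟨_, hW1⟩, h⟩

/-! ### The main theorem -/

section

variable {K : Type*} [Field K]

theorem realizesAllMultisetsOfLengths_of_comap {V : ValuationSubring K} {p : K}
    (hp : IsUniformizer V p) (harch : PowAbsorbing V p) [Finite (IsLocalRing.ResidueField V)]
    {L : Type*} [Field L] [Algebra L K] [FiniteDimensional L K] {W : ValuationSubring L}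
    (hWV : ¬ W ≤ V.comap (algebraMap L K)) (hW : W ≠ ⊤)
    (h : (∃ r, IsUniformizer W r) ∨ Finite (IsLocalRing.ResidueField W)) :
    RealizesAllMultisetsOfLengths V := by
  obtain ⟨W', rfl⟩ := exists_comap_eq (K := K) W
  refine realizesAllMultisetsOfLengths_of_not_le (W := W') hp harch (fun hle => hWV ?_) ?_ ?_
  · exact fun x hx => hle hx
  · rintro rfl
    exact hW rfl
  · rcases h with ⟨r, hr⟩ | h
    · exact Or.inl (exists_isUniformizer_of_comap hr)
    · exact Or.inr (finite_residueField_of_comap L)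

theorem realizesAllMultisetsOfLengths_of_finiteDimensional {L : Type*} [Field L] [Algebra L K]
    [FiniteDimensional L K]
    (hdisc : ∀ V : ValuationSubring L, V ≠ ⊤ →
      (∃ p, IsUniformizer V p ∧ PowAbsorbing V p) ∧ Finite (IsLocalRing.ResidueField V))
    (hind : ∀ V : ValuationSubring L, V ≠ ⊤ →
      ∃ W : ValuationSubring L, (∃ r, IsUniformizer W r) ∧ ¬ W ≤ V)
    {V : ValuationSubring K} (hV : V ≠ ⊤) : RealizesAllMultisetsOfLengths V := by
  have hV₀ := comap_ne_top L hV
  obtain ⟨⟨r, hr, hra⟩, _⟩ := hdisc _ hV₀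
  obtain ⟨W, ⟨q, hq⟩, hWV⟩ := hind _ hV₀
  obtain ⟨p, hp⟩ := exists_isUniformizer_of_comap hr
  have := finite_residueField_of_comap L (V := V)
  exact realizesAllMultisetsOfLengths_of_comap hp (powAbsorbing_of_comap hr hra hp) hWV hq.ne_top
    (Or.inl ⟨q, hq⟩)

/-- All but one of the independent generators are moved into the base field. -/
theorem IsProperPurelyTranscendental.exists_simple {F : Type*} [Field F] [Algebra F K]
    (h : IsProperPurelyTranscendental F K) :
    ∃ (E : IntermediateField F K) (s : K), Transcendental E s ∧
      IntermediateField.adjoin E {s} = ⊤ := by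
  obtain ⟨S, ⟨s, hs⟩, hind, htop⟩ := h
  have htr := hind.transcendental_adjoin (s := {⟨s, hs⟩}ᶜ) (i := ⟨s, hs⟩) (by simp)
  set T : Set K := (fun i : S => (i : K)) '' {⟨s, hs⟩}ᶜ with hT
  refine ⟨IntermediateField.adjoin F T, s, ?_, ?_⟩
  · open scoped IntermediateField.algebraAdjoinAdjoin in
    exact fun halg => htr ((IsFractionRing.isAlgebraic_iff (Algebra.adjoin F T)
      (IntermediateField.adjoin F T) K).2 halg)
  · rw [← IntermediateField.restrictScalars_eq_top_iff (K := F),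
      IntermediateField.adjoin_adjoin_left, ← top_le_iff, ← htop]
    refine IntermediateField.adjoin.mono F _ _ fun x hx => ?_
    by_cases hxs : x = s
    · exact Or.inr hxs
    · exact Or.inl ⟨⟨x, hx⟩, fun h => hxs (congrArg Subtype.val h), rfl⟩

end

theorem mainTheorem2 {K : Type*} [Field K] (V : ValuationSubring K) :
    -- (1) a (non-trivial) valuation ring of a global field
    (IsGlobalField K → V ≠ ⊤ → RealizesAllMultisetsOfLengths V) ∧
    -- (2) a DVR with finite residue field, purely transcendental quotient field
    (∀ (F : Type*) [Field F] [Algebra F K],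
      IsDiscreteValuationRing V → Finite (IsLocalRing.ResidueField V) →
      IsProperPurelyTranscendental F K →
      RealizesAllMultisetsOfLengths V) ∧
    -- (3) a DVR with finite residue field whose quotient field is finite over `L`, where `L` has a
    -- (non-trivial) valuation ring independent from `V ∩ L` with the required property
    (∀ (L : Type*) [Field L] [Algebra L K],
      IsDiscreteValuationRing V → Finite (IsLocalRing.ResidueField V) →
      FiniteDimensional L K →
      (∃ W : ValuationSubring L, W ≠ ⊤ ∧
        IndependentValuationRings W (V.comap (algebraMap L K)) ∧
        ((IsLocalRing.maximalIdeal W).IsPrincipal ∨ Finite (IsLocalRing.ResidueField W))) →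
      RealizesAllMultisetsOfLengths V) := by
  refine ⟨fun hK hV => ?_, fun F _ _ hV _ hF => ?_, fun L _ _ hV _ _ hW => ?_⟩
  · rcases hK with hK | ⟨F, _, _, _, _⟩
    · exact realizesAllMultisetsOfLengths_of_finiteDimensional (L := ℚ)
        (fun _ => discrete_of_rat) (fun _ => exists_independent_rat) hV
    · exact realizesAllMultisetsOfLengths_of_finiteDimensional (L := RatFunc F)
        (fun _ => discrete_of_transcendental RatFunc.transcendental_X RatFunc.adjoin_X)
        (fun _ => exists_independent_of_transcendental RatFunc.transcendental_X RatFunc.adjoin_X) hV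
  · obtain ⟨p, hp, hpa⟩ := exists_uniformizer_of_isDiscreteValuationRing (V := V)
    obtain ⟨E, s, hs, htop⟩ := hF.exists_simple
    obtain ⟨W, ⟨r, hr⟩, hWV⟩ := exists_independent_of_transcendental hs htop hp.ne_top
    exact realizesAllMultisetsOfLengths_of_not_le hp hpa hWV hr.ne_top (Or.inl ⟨r, hr⟩)
  · obtain ⟨p, hp, hpa⟩ := exists_uniformizer_of_isDiscreteValuationRing (V := V)
    obtain ⟨W, hWtop, hind, hW⟩ := hW
    refine realizesAllMultisetsOfLengths_of_comap hp hpa (W := W) (fun hle => ?_) hWtop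
      (hW.imp_left (exists_isUniformizer hWtop))
    -- If `W` were contained in `V ∩ L`, independence would give `V ∩ L = L`, which is impossible
    -- for a proper `V` in a finite extension.
    refine comap_ne_top L hp.ne_top (ValuationSubring.toSubring_injective ?_)
    rw [ValuationSubring.toSubring_top, ← hind]
    exact (sup_eq_right.2 (show W.toSubring ≤ _ from hle)).symm
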